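/- All sets and functions are considered on $\mathbb R^2$ with Lebesgue measure $|\cdot|$, and equalities and inclusions between sets, as well as the constraints on functions below, are understood up to null sets. For $u\in L^1(\mathbb R^2)$ let $$TV(u)=\sup\Big\{\int_{\mathbb R^2}u\,\operatorname{div}z\,dx:\ z\in C_c^\infty(\mathbb R^2;\mathbb R^2),\ |z(x)|\le 1\ \text{for all }x\Big\},$$ let $BV(\mathbb R^2)=\{u\in L^1(\mathbb R^2): TV(u)<\infty\}$, and let $\operatorname{Per}(E)=TV(1_E)$ for a Borel set $E$ of finite measure. A Cheeger set of a set $\Omega_0$ is a Borel set $E_0\subset\Omega_0$ with $0<|E_0|<\infty$ and finite perimeter that minimizes $\operatorname{Per}(E)/|E|$ among all Borel sets $E\subset\Omega_0$ with $0<|E|<\infty$. Let $\Omega\subset\mathbb R^2$ be open and bounded, let $\Omega_s\subset\Omega$ be a Borel set with $|\Omega_s|>0$, and suppose that the class $$BV_{\diamond,1}=\Big\{v\in BV(\mathbb R^2):\ \int_\Omega v=0,\ v= 1\text{ in }\Omega_s,\ v= 0\text{ in }\mathbb R^2\setminus\Omega\Big\}$$ is not empty (as is the case, for example, if $\Omega_s$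 has finite perimeter and $|\Omega\setminus\Omega_s|>0$). For a Borel set $\Omega_-$ with $0<|\Omega_-|<\infty$ and $\operatorname{Per}(\Omega_-)<\infty$ put $$\mathcal T(E)=\operatorname{Per}(E)+\frac{\operatorname{Per}(\Omega_-)}{|\Omega_-|}\,|E| .$$ **Theorem.** $TV$ has a minimizer in $BV_{\diamond,1}$. Let $u$ be any minimizer of $TV$ in $BV_{\diamond,1}$, and let $\Theta_+=\{u>0\}$ be the set on which $u^+$ does not vanish. Then $\Omega\setminus\Theta_+$ has a Cheeger set, and for every Cheeger set $\Omega_-$ of $\Omega\setminus\Theta_+$ the following hold: 1. $\mathcal T$ attains its minimum over the Borel sets $E$ with $\Omega_s\subset E\subset\Omega\setminus\Omega_-$; 2. for every such minimizer $\Omega_1$ of $\mathcal T$, the three-valued function $$u_c=1_{\Omega_1}-\frac{|\Omega_1|}{|\Omega_-|}\,1_{\Omega_-}$$ is a minimizer of $TV$ in $BV_{\diamond,1}$; 3. for every $0\le t<1$, the superlevel set $\{u>t\}$ minimizes $\mathcal T$ over the Borel sets $E$ with $\Omega_s\subset E\subset\Omega\setminus\Omega_-$. -/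

import Mathlib

open MeasureTheory Set

noncomputable section

/-- The plane `ℝ²` with its Euclidean norm and Lebesgue measure. -/
abbrev Plane : Type := EuclideanSpace ℝ (Fin 2)

/-- The divergence `∂₁ z₁ + ∂₂ z₂` of a vector field on the plane. -/
def divergence (z : Plane → Plane) (x : Plane) : ℝ :=
  ∑ i : Fin 2, (fderiv ℝ z x (EuclideanSpace.single i 1)) i

/-- Test fields for the total variation: smooth, compactly supported vector fields whose
Euclidean length is at most one everywhere. -/
def testFields : Set (Plane → Plane) :=
  {z | ContDiff ℝ ((⊤ : ℕ∞) : WithTop ℕ∞) z ∧ HasCompactSupport z ∧ ∀ x, ‖z x‖ ≤ 1}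

/-- The total variation on the whole plane, `TV u = sup {∫ u div z : z a test field}`.
The supremum is nonnegative (take `z = 0`), so nothing is lost by `ENNReal.ofReal`. -/
def TV (u : Plane → ℝ) : ENNReal :=
  ⨆ z ∈ testFields, ENNReal.ofReal (∫ x, u x * divergence z x)

/-- The perimeter of a set (in the whole plane). -/
def Per (E : Set Plane) : ENNReal :=
  TV (E.indicator fun _ => 1)

/-- `BV(ℝ²)`: integrable functions of finite total variation, represented by Borel functions. -/
def BV : Set (Plane → ℝ) :=
  {u | Measurable u ∧ Integrable u ∧ TV u < ⊤}

/-- The class of `v ∈ BV(ℝ²)` with `∫_Ω v = 0`, `v = 1` a.e. in `Ωs` and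
`v = 0` a.e. outside `Ω`. -/
def BVExchange (Ω Ωs : Set Plane) : Set (Plane → ℝ) :=
  {v | v ∈ BV ∧ ∫ x in Ω, v x = 0 ∧
    (∀ᵐ x, x ∈ Ωs → v x = 1) ∧ (∀ᵐ x, x ∉ Ω → v x = 0)}

/-- `u` minimizes the total variation over `BVExchange Ω Ωs`. -/
def IsTVMinimizer (Ω Ωs : Set Plane) (u : Plane → ℝ) : Prop :=
  u ∈ BVExchange Ω Ωs ∧ ∀ v ∈ BVExchange Ω Ωs, TV u ≤ TV v

/-- The set where `u⁺` does not vanish; for an a.e.-class of functions it is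
determined up to a null set. -/
def posSupport (u : Plane → ℝ) : Set Plane :=
  {x | 0 < u x}

/-- The competitors of the Cheeger problem in `Ω₀`: Borel sets of positive finite area that are
contained in `Ω₀` up to a null set. -/
def cheegerClass (Ω₀ : Set Plane) : Set (Set Plane) :=
  {E | MeasurableSet E ∧ E ≤ᵐ[volume] Ω₀ ∧ 0 < volume E ∧ volume E < ⊤}

/-- `E₀` is a Cheeger set of `Ω₀`: a set of finite perimeter that minimizes `Per E / |E|`. -/
def IsCheegerSet (Ω₀ E₀ : Set Plane) : Prop :=
  E₀ ∈ cheegerClass Ω₀ ∧ Per E₀ < ⊤ ∧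
    ∀ E ∈ cheegerClass Ω₀, Per E₀ / volume E₀ ≤ Per E / volume E

/-- The functional `T(E) = Per E + (Per Ωm / |Ωm|) |E|`. -/
def TFun (Ωm E : Set Plane) : ENNReal :=
  Per E + Per Ωm / volume Ωm * volume E

/-- The Borel sets `E` with `Ωs ⊆ E ⊆ Ω \ Ωm` up to null sets. -/
def betweenClass (Ω Ωs Ωm : Set Plane) : Set (Set Plane) :=
  {E | MeasurableSet E ∧ Ωs ≤ᵐ[volume] E ∧ E ≤ᵐ[volume] (Ω \ Ωm : Set Plane)}

/-- `E₁` minimizes `T` over the Borel sets `E` with `Ωs ⊆ E ⊆ Ω \ Ωm`. -/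
def IsTMinimizer (Ω Ωs Ωm E₁ : Set Plane) : Prop :=
  E₁ ∈ betweenClass Ω Ωs Ωm ∧ ∀ E ∈ betweenClass Ω Ωs Ωm, TFun Ωm E₁ ≤ TFun Ωm E

/-- The three-valued function `1_{Ω₁} - (|Ω₁| / |Ωm|) 1_{Ωm}`. -/
def threeValued (Ω₁ Ωm : Set Plane) (x : Plane) : ℝ :=
  Ω₁.indicator (fun _ => (1 : ℝ)) x -
    (volume Ω₁).toReal / (volume Ωm).toReal * Ωm.indicator (fun _ => (1 : ℝ)) x

end

/-!
The argument rests on three facts about functions of bounded variation with bounded support.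

* Cutting the graph of a function at a height `s ≥ 0` splits its total variation,
  `TV (min u s) + TV (max (u - s) 0) ≤ TV u` (`TV_min_add_TV_max_le`). It is the only form of the
  coarea formula that is needed. For smooth `u` and smooth truncations it is the chain rule; in
  general it follows by mollification and lower semicontinuity.
* The Sobolev inequality `‖u‖₂ ≤ C TV u` (`exists_eLpNorm_two_le_TV`).
* Total variation is lower semicontinuous, being a supremum of continuous linear functionals.

A minimizer exists because the admissible functions with total variation close to the infimum form
nested closed convex sets in `L²`, bounded by the Sobolev inequality, and such sets have a common
point (`exists_isTVMinimizer`).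

Let `u` be a minimizer, `A = ∫ u⁺ = ∫ u⁻` and `λ = TV u⁻ / A`. Replacing `u⁻` by a multiple of any
nonnegative `w` supported where `u ≤ 0` shows that `TV w ≥ λ ∫ w`
(`TV_negPart_mul_integral_le`). Cutting `u⁻` at height `ε` makes this an equality for the slice
`min u⁻ ε`; dividing by `ε` and letting `ε → 0` gives `Per {u < 0} ≤ λ |{u < 0}|`, so `{u < 0}` is
a Cheeger set and `λ` is the Cheeger constant (`isCheegerSet_neg`).

For any Cheeger set `Ωm`, a function `w ≥ 0` with `w = 1` on `Ωs` yields the competitor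
`w - (∫ w / |Ωm|) 1_Ωm`, whence `TV u ≤ TV w + λ ∫ w` (`mul_TV_le_relaxed`); for `w = 1_E` the right
side is `TFun Ωm E`. Conversely, `TV w + λ ∫ w` is at most `TV u` for `w = u⁺`. Cut `u⁺` at the
heights `t` and `t + ε`: the three slices take the values `t`, `ε` and `1 - t - ε` on `Ωs`, so each
carries at least the corresponding share of `TV u`, hence exactly that share. Dividing the middle
slice by `ε` and letting `ε → 0` gives
`TFun Ωm {u > t} ≤ TV u` (`TFun_superlevel_le`). So the minimum of `TFun Ωm` is `TV u`; it is
attained by all these level sets, and each set attaining it gives a three-valued minimizer.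
-/

open Filter Topology
open scoped ContDiff

/-! ### Test fields and elementary properties of the total variation -/

lemma continuous_divergence {z : Plane → Plane} (hz : z ∈ testFields) :
    Continuous (divergence z) := by
  have h1 : Continuous (fderiv ℝ z) := hz.1.continuous_fderiv (by simp)
  unfold divergence
  fun_prop

lemma hasCompactSupport_divergence {z : Plane → Plane} (hz : z ∈ testFields) :
    HasCompactSupport (divergence z) := by
  have h1 : HasCompactSupport (fderiv ℝ z) := hz.2.1.fderiv (𝕜 := ℝ)
  refine h1.mono ?_
  intro x hx
  contrapose! hx
  simp only [Function.mem_support, ne_eq, not_not] at hx ⊢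
  simp [divergence, hx]

lemma exists_bound_divergence {z : Plane → Plane} (hz : z ∈ testFields) :
    ∃ C, ∀ x, ‖divergence z x‖ ≤ C :=
  (hasCompactSupport_divergence hz).exists_bound_of_continuous (continuous_divergence hz)

lemma integrable_mul_divergence {u : Plane → ℝ} (hu : Integrable u) {z : Plane → Plane}
    (hz : z ∈ testFields) : Integrable fun x => u x * divergence z x := by
  obtain ⟨C, hC⟩ := exists_bound_divergence hz
  exact hu.mul_bdd (continuous_divergence hz).aestronglyMeasurable (.of_forall hC)

lemma divergence_neg (z : Plane → Plane) (x : Plane) :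
    divergence (-z) x = -divergence z x := by
  simp [divergence, fderiv_neg]

lemma neg_mem_testFields {z : Plane → Plane} (hz : z ∈ testFields) : -z ∈ testFields :=
  ⟨hz.1.neg, hz.2.1.neg, fun x => by simpa using hz.2.2 x⟩

lemma zero_mem_testFields : (0 : Plane → Plane) ∈ testFields :=
  ⟨contDiff_const, HasCompactSupport.zero, by simp⟩

lemma ofReal_integral_le_TV (u : Plane → ℝ) {z : Plane → Plane} (hz : z ∈ testFields) :
    ENNReal.ofReal (∫ x, u x * divergence z x) ≤ TV u :=
  le_iSup₂ (f := fun z (_ : z ∈ testFields) => ENNReal.ofReal (∫ x, u x * divergence z x)) z hz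

lemma TV_congr {u v : Plane → ℝ} (h : u =ᵐ[volume] v) : TV u = TV v := by
  unfold TV
  congr! 3 with z hz
  exact congrArg _ (integral_congr_ae (h.mono fun x hx => by simp [hx]))

lemma TV_add_le {u v : Plane → ℝ} (hu : Integrable u) (hv : Integrable v) :
    TV (fun x => u x + v x) ≤ TV u + TV v := by
  refine iSup₂_le fun z hz => ?_
  simp_rw [add_mul]
  rw [integral_add (integrable_mul_divergence hu hz) (integrable_mul_divergence hv hz)]
  exact ENNReal.ofReal_add_le.trans
    (add_le_add (ofReal_integral_le_TV u hz) (ofReal_integral_le_TV v hz))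

lemma TV_const_mul_le (c : ℝ) (u : Plane → ℝ) :
    TV (fun x => c * u x) ≤ ENNReal.ofReal |c| * TV u := by
  refine iSup₂_le fun z hz => ?_
  simp_rw [mul_assoc]
  rw [integral_const_mul]
  rcases le_total 0 c with hc | hc
  · rw [ENNReal.ofReal_mul hc, abs_of_nonneg hc]
    gcongr
    exact ofReal_integral_le_TV u hz
  · have h := ofReal_integral_le_TV u (neg_mem_testFields hz)
    simp_rw [divergence_neg, mul_neg] at h
    rw [integral_neg] at h
    rw [abs_of_nonpos hc, ← neg_mul_neg, ENNReal.ofReal_mul (by linarith)]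
    gcongr

/-- Lower semicontinuity of the sum of two total variations. -/
lemma TV_add_TV_le_of_tendsto {ι : Type*} {l : Filter ι} [l.NeBot] {a b : ι → Plane → ℝ}
    {a' b' : Plane → ℝ} {c : ENNReal}
    (ha : ∀ z ∈ testFields,
      Tendsto (fun n => ∫ x, a n x * divergence z x) l (𝓝 (∫ x, a' x * divergence z x)))
    (hb : ∀ z ∈ testFields,
      Tendsto (fun n => ∫ x, b n x * divergence z x) l (𝓝 (∫ x, b' x * divergence z x)))
    (h : ∀ᶠ n in l, TV (a n) + TV (b n) ≤ c) : TV a' + TV b' ≤ c := by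
  refine ENNReal.biSup_add_biSup_le' ⟨0, zero_mem_testFields⟩ ⟨0, zero_mem_testFields⟩
    fun z hz w hw => ?_
  refine le_of_tendsto ((ENNReal.tendsto_ofReal (ha z hz)).add
    (ENNReal.tendsto_ofReal (hb w hw))) (h.mono fun n hn => ?_)
  exact (add_le_add (ofReal_integral_le_TV _ hz) (ofReal_integral_le_TV _ hw)).trans hn

/-- Lower semicontinuity of the total variation, tested against divergences only. -/
lemma TV_le_of_tendsto {ι : Type*} {l : Filter ι} [l.NeBot] {a : ι → Plane → ℝ}
    {a' : Plane → ℝ} {c : ENNReal}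
    (ha : ∀ z ∈ testFields,
      Tendsto (fun n => ∫ x, a n x * divergence z x) l (𝓝 (∫ x, a' x * divergence z x)))
    (h : ∀ᶠ n in l, TV (a n) ≤ c) : TV a' ≤ c := by
  refine iSup₂_le fun z hz => le_of_tendsto (ENNReal.tendsto_ofReal (ha z hz))
    (h.mono fun n hn => (ofReal_integral_le_TV _ hz).trans hn)

/-- `L¹` convergence implies convergence of the integrals against divergences. -/
lemma tendsto_integral_mul_divergence {ι : Type*} {l : Filter ι} {a : ι → Plane → ℝ}
    {a' : Plane → ℝ} (hai : ∀ n, Integrable (a n)) (ha' : Integrable a')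
    (h : Tendsto (fun n => ∫ x, ‖a n x - a' x‖) l (𝓝 0)) {z : Plane → Plane}
    (hz : z ∈ testFields) :
    Tendsto (fun n => ∫ x, a n x * divergence z x) l (𝓝 (∫ x, a' x * divergence z x)) := by
  obtain ⟨C, hC⟩ := exists_bound_divergence hz
  rw [tendsto_iff_norm_sub_tendsto_zero]
  refine squeeze_zero (fun _ => norm_nonneg _) (fun n => ?_) (by simpa using h.mul_const C)
  rw [← integral_sub (integrable_mul_divergence (hai n) hz) (integrable_mul_divergence ha' hz),
    ← integral_mul_const]
  refine norm_integral_le_of_norm_le (((hai n).sub ha').norm.mul_const C) (.of_forall fun x => ?_)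
  rw [← sub_mul, norm_mul]
  exact mul_le_mul_of_nonneg_left (hC x) (norm_nonneg _)

/-- Dominated convergence for the integrals against divergences. -/
lemma tendsto_integral_mul_divergence_of_dominated {a : ℕ → Plane → ℝ} {a' g : Plane → ℝ}
    (hai : ∀ n, AEStronglyMeasurable (a n)) (hg : Integrable g)
    (hb : ∀ n x, ‖a n x‖ ≤ g x) (h : ∀ x, Tendsto (fun n => a n x) atTop (𝓝 (a' x)))
    {z : Plane → Plane} (hz : z ∈ testFields) :
    Tendsto (fun n => ∫ x, a n x * divergence z x) atTop
      (𝓝 (∫ x, a' x * divergence z x)) := by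
  refine tendsto_integral_of_dominated_convergence (fun x => g x * ‖divergence z x‖)
    (fun n => (hai n).mul (continuous_divergence hz).aestronglyMeasurable) ?_
    (fun n => .of_forall fun x => ?_) (.of_forall fun x => (h x).mul_const _)
  · obtain ⟨C, hC⟩ := exists_bound_divergence hz
    exact hg.mul_bdd (continuous_divergence hz).norm.aestronglyMeasurable
      (.of_forall fun x => by simpa using hC x)
  · rw [norm_mul]
    exact mul_le_mul_of_nonneg_right (hb n x) (norm_nonneg _)

/-! ### Smooth functions -/

lemma sum_smul_single (y : Plane) :
    ∑ i : Fin 2, y i • (EuclideanSpace.single i 1 : Plane) = y := by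
  ext j
  fin_cases j <;> simp

/-- Integration by parts against a test field. -/
lemma integral_mul_divergence_eq {v : Plane → ℝ} (hv : ContDiff ℝ ∞ v)
    (hvc : HasCompactSupport v) {z : Plane → Plane} (hz : ContDiff ℝ ∞ z) :
    ∫ x, v x * divergence z x = -∫ x, fderiv ℝ v x (z x) := by
  have hzi : ∀ i : Fin 2, ContDiff ℝ ∞ fun x => z x i := fun i =>
    (EuclideanSpace.proj (𝕜 := ℝ) i).contDiff.comp hz
  have hd : ∀ (i : Fin 2) (x y : Plane), fderiv ℝ (fun x => z x i) x y = (fderiv ℝ z x y) i := by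
    intro i x y
    have h1 : HasFDerivAt (fun x => z x i)
        ((EuclideanSpace.proj (𝕜 := ℝ) i).comp (fderiv ℝ z x)) x :=
      (EuclideanSpace.proj (𝕜 := ℝ) i : Plane →L[ℝ] ℝ).hasFDerivAt.comp x
        ((hz.differentiable (by simp)) x).hasFDerivAt
    rw [h1.fderiv]
    rfl
  have hvd : Continuous (fderiv ℝ v) := hv.continuous_fderiv (by simp)
  have hvdc : HasCompactSupport (fderiv ℝ v) := hvc.fderiv (𝕜 := ℝ)
  have hI1 : ∀ i : Fin 2, Integrable fun x =>
      v x * fderiv ℝ (fun x => z x i) x (EuclideanSpace.single i 1) := fun i => by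
    have := (hzi i).continuous_fderiv (by simp)
    have := hv.continuous
    exact Continuous.integrable_of_hasCompactSupport (by fun_prop) hvc.mul_right
  have hI2 : ∀ i : Fin 2, Integrable fun x =>
      fderiv ℝ v x (EuclideanSpace.single i 1) * z x i := fun i => by
    have := (hzi i).continuous
    refine Continuous.integrable_of_hasCompactSupport (by fun_prop)
      (HasCompactSupport.mul_right (hvdc.mono fun x hx => ?_))
    contrapose! hx
    simp only [Function.mem_support, ne_eq, not_not] at hx ⊢
    simp [hx]
  have hI3 : ∀ i : Fin 2, Integrable fun x => v x * z x i := fun i =>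
    Continuous.integrable_of_hasCompactSupport (hv.continuous.mul (hzi i).continuous)
      hvc.mul_right
  have key : ∀ i : Fin 2, ∫ x, v x * fderiv ℝ (fun x => z x i) x (EuclideanSpace.single i 1)
      = -∫ x, fderiv ℝ v x (EuclideanSpace.single i 1) * z x i := fun i =>
    integral_mul_fderiv_eq_neg_fderiv_mul_of_integrable (hI2 i) (hI1 i) (hI3 i)
      (fun x _ => hv.differentiable (by simp) x) (fun x _ => (hzi i).differentiable (by simp) x)
  have e1 : ∀ x, v x * divergence z x =
      ∑ i : Fin 2, v x * fderiv ℝ (fun x => z x i) x (EuclideanSpace.single i 1) := fun x => by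
    rw [divergence, Finset.mul_sum]
    simp_rw [hd]
  have e2 : ∀ x, fderiv ℝ v x (z x) =
      ∑ i : Fin 2, fderiv ℝ v x (EuclideanSpace.single i 1) * z x i := fun x => by
    conv_lhs => rw [← sum_smul_single (z x), map_sum]
    simp [mul_comm]
  simp_rw [e1, e2]
  rw [integral_finsetSum _ fun i _ => hI1 i, integral_finsetSum _ fun i _ => hI2 i,
    ← Finset.sum_neg_distrib]
  exact Finset.sum_congr rfl fun i _ => key i

lemma integrable_norm_fderiv {v : Plane → ℝ} (hv : ContDiff ℝ ∞ v)
    (hvc : HasCompactSupport v) : Integrable fun x => ‖fderiv ℝ v x‖ :=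
  ((hv.continuous_fderiv (by simp)).integrable_of_hasCompactSupport
    (hvc.fderiv (𝕜 := ℝ))).norm

lemma TV_le_integral_norm_fderiv {v : Plane → ℝ} (hv : ContDiff ℝ ∞ v)
    (hvc : HasCompactSupport v) : TV v ≤ ENNReal.ofReal (∫ x, ‖fderiv ℝ v x‖) := by
  refine iSup₂_le fun z hz => ENNReal.ofReal_le_ofReal ?_
  rw [integral_mul_divergence_eq hv hvc hz.1]
  refine (neg_le_abs _).trans ((Real.norm_eq_abs _).ge.trans <|
    norm_integral_le_of_norm_le (integrable_norm_fderiv hv hvc)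
    (.of_forall fun x => ?_))
  exact ((fderiv ℝ v x).le_opNorm _).trans (mul_le_of_le_one_right (norm_nonneg _) (hz.2.2 x))

/-- For smooth functions the total variation is at least `∫ ‖∇v‖`, as seen by testing with
regularizations of `-∇v / ‖∇v‖`. -/
lemma integral_norm_fderiv_le_TV {v : Plane → ℝ} (hv : ContDiff ℝ ∞ v)
    (hvc : HasCompactSupport v) : ENNReal.ofReal (∫ x, ‖fderiv ℝ v x‖) ≤ TV v := by
  set D : Plane → Plane := fun x => (InnerProductSpace.toDual ℝ Plane).symm (fderiv ℝ v x)
    with hD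
  have hDs : ContDiff ℝ ∞ D :=
    (InnerProductSpace.toDual ℝ Plane).symm.toContinuousLinearEquiv.contDiff.comp
      (hv.fderiv_right (by simp))
  have hDn : ∀ x, ‖D x‖ = ‖fderiv ℝ v x‖ := fun x => by simp [hD]
  have hDD : ∀ x, fderiv ℝ v x (D x) = ‖D x‖ ^ 2 := fun x => by
    rw [← real_inner_self_eq_norm_sq]
    exact (InnerProductSpace.toDual_symm_apply (x := D x) (y := fderiv ℝ v x)).symm
  have hDc : HasCompactSupport D := by
    refine (hvc.fderiv (𝕜 := ℝ)).mono fun x hx => ?_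
    contrapose! hx
    simp only [Function.mem_support, ne_eq, not_not] at hx ⊢
    simp [hD, hx]
  set δ : ℕ → ℝ := fun n => 1 / ((n : ℝ) + 1) with hδ
  have hδ0 : ∀ n, 0 < δ n := fun n => Nat.one_div_pos_of_nat
  have hpos : ∀ n x, 0 < ‖D x‖ ^ 2 + δ n ^ 2 := fun n x => by have := hδ0 n; positivity
  -- the normalized gradients, regularized where the gradient is small
  set z : ℕ → Plane → Plane := fun n x => -((Real.sqrt (‖D x‖ ^ 2 + δ n ^ 2))⁻¹ • D x) with hz
  have hle : ∀ n x, ‖D x‖ ≤ Real.sqrt (‖D x‖ ^ 2 + δ n ^ 2) := fun n x =>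
    Real.le_sqrt_of_sq_le (by nlinarith [sq_nonneg (δ n)])
  have hzt : ∀ n, z n ∈ testFields := fun n => by
    refine ⟨?_, ?_, fun x => ?_⟩
    · have h1 : ContDiff ℝ ∞ fun x => ‖D x‖ ^ 2 + δ n ^ 2 := (hDs.norm_sq ℝ).add contDiff_const
      have h2 := h1.sqrt fun x => (hpos n x).ne'
      exact ((h2.inv fun x => (Real.sqrt_pos.2 (hpos n x)).ne').smul hDs).neg
    · refine hDc.mono fun x hx => ?_
      contrapose! hx
      simp only [Function.mem_support, ne_eq, not_not] at hx ⊢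
      simp [hz, hx]
    · rw [hz, norm_neg, norm_smul, norm_inv, Real.norm_of_nonneg (Real.sqrt_nonneg _)]
      exact inv_mul_le_one_of_le₀ (hle n x) (Real.sqrt_nonneg _)
  have hval : ∀ n, ∫ x, v x * divergence (z n) x =
      ∫ x, ‖D x‖ ^ 2 / Real.sqrt (‖D x‖ ^ 2 + δ n ^ 2) := fun n => by
    rw [integral_mul_divergence_eq hv hvc (hzt n).1, ← integral_neg]
    congr 1
    ext x
    simp only [hz, map_neg, neg_neg, map_smul, hDD, smul_eq_mul]
    rw [div_eq_inv_mul]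
  have hlim : Tendsto (fun n => ∫ x, ‖D x‖ ^ 2 / Real.sqrt (‖D x‖ ^ 2 + δ n ^ 2)) atTop
      (𝓝 (∫ x, ‖D x‖)) := by
    refine tendsto_integral_of_dominated_convergence (fun x => ‖D x‖) (fun n => ?_)
      (hDs.continuous.integrable_of_hasCompactSupport hDc).norm
      (fun n => .of_forall fun x => ?_) (.of_forall fun x => ?_)
    · have := hDs.continuous
      refine Continuous.aestronglyMeasurable (Continuous.div (by fun_prop) (by fun_prop) ?_)
      exact fun x => (Real.sqrt_pos.2 (hpos n x)).ne'
    · rw [Real.norm_of_nonneg (by positivity), div_le_iff₀ (Real.sqrt_pos.2 (hpos n x)),]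
      nlinarith [mul_le_mul_of_nonneg_left (hle n x) (norm_nonneg (D x))]
    · rcases eq_or_ne (D x) 0 with h0 | h0
      · simp [h0]
      · have h1 : Tendsto (fun n => ‖D x‖ ^ 2 + δ n ^ 2) atTop (𝓝 (‖D x‖ ^ 2 + 0 ^ 2)) :=
          (tendsto_one_div_add_atTop_nhds_zero_nat.pow 2).const_add _
        have h2 := (tendsto_const_nhds (x := ‖D x‖ ^ 2)).div h1.sqrt
          (by simpa using h0)
        have e : ‖D x‖ ^ 2 / Real.sqrt (‖D x‖ ^ 2 + 0 ^ 2) = ‖D x‖ := by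
          rw [zero_pow two_ne_zero, add_zero, Real.sqrt_sq (norm_nonneg _), pow_two,
            mul_self_div_self]
        rwa [e] at h2
  simp_rw [← hDn]
  refine le_of_tendsto (ENNReal.tendsto_ofReal hlim) (.of_forall fun n => ?_)
  rw [← hval]
  exact ofReal_integral_le_TV v (hzt n)

/-! ### Mollification -/

open scoped Convolution in
/-- A convolution with a probability density is an average of translates, so it does not increase
the total variation. -/
lemma TV_convolution_le {ρ u : Plane → ℝ} (hρ : Integrable ρ) (hρ0 : ∀ x, 0 ≤ ρ x)
    (hρ1 : ∫ x, ρ x = 1) (hu : Integrable u) :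
    TV (ρ ⋆[ContinuousLinearMap.lsmul ℝ ℝ, volume] u) ≤ TV u := by
  rcases eq_or_ne (TV u) ⊤ with htop | htop
  · simp [htop]
  refine iSup₂_le fun z hz => ?_
  obtain ⟨C, hC⟩ := exists_bound_divergence hz
  have hint : Integrable (fun p : Plane × Plane =>
      ρ p.2 * u (p.1 - p.2) * divergence z p.1) (volume.prod volume) :=
    (hρ.convolution_integrand (ContinuousLinearMap.lsmul ℝ ℝ) hu).mul_bdd
      ((continuous_divergence hz).comp continuous_fst).aestronglyMeasurable
      (.of_forall fun p => hC p.1)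
  have hshift : ∀ t, ∫ x, ρ t * u (x - t) * divergence z x ≤ ρ t * (TV u).toReal := fun t => by
    have hzt : (fun x => z (x + t)) ∈ testFields :=
      ⟨hz.1.comp (contDiff_id.add contDiff_const),
        hz.2.1.comp_homeomorph (Homeomorph.addRight t), fun x => hz.2.2 _⟩
    have hdt : ∀ x, divergence (fun x => z (x + t)) x = divergence z (x + t) := fun x => by
      simp [divergence, fderiv_comp_add_right]
    have h1 := ofReal_integral_le_TV u hzt
    simp_rw [hdt] at h1
    rw [ENNReal.ofReal_le_iff_le_toReal htop] at h1
    have h2 := integral_sub_right_eq_self (μ := (volume : Measure Plane))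
      (fun x => u x * divergence z (x + t)) t
    simp only [sub_add_cancel] at h2
    simp_rw [mul_assoc]
    rw [integral_const_mul, h2]
    exact mul_le_mul_of_nonneg_left h1 (hρ0 t)
  refine ENNReal.ofReal_le_of_le_toReal ?_
  calc ∫ x, (ρ ⋆[ContinuousLinearMap.lsmul ℝ ℝ, volume] u) x * divergence z x
      = ∫ x, ∫ t, ρ t * u (x - t) * divergence z x := by
        congr 1
        ext x
        rw [convolution, ← integral_mul_const]
        rfl
    _ = ∫ t, ∫ x, ρ t * u (x - t) * divergence z x := integral_integral_swap hint
    _ ≤ ∫ t, ρ t * (TV u).toReal :=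
        integral_mono hint.integral_prod_right (hρ.mul_const _) hshift
    _ = (TV u).toReal := by rw [integral_mul_const, hρ1, one_mul]

open scoped Convolution in
lemma integral_norm_convolution_le {ρ u : Plane → ℝ} (hρ : Integrable ρ) (hρ0 : ∀ x, 0 ≤ ρ x)
    (hρ1 : ∫ x, ρ x = 1) (hu : Integrable u) :
    ∫ x, ‖(ρ ⋆[ContinuousLinearMap.lsmul ℝ ℝ, volume] u) x‖ ≤ ∫ x, ‖u x‖ := by
  have h1 : ∀ x, ‖(ρ ⋆[ContinuousLinearMap.lsmul ℝ ℝ, volume] u) x‖ ≤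
      (ρ ⋆[ContinuousLinearMap.lsmul ℝ ℝ, volume] fun y => ‖u y‖) x := fun x => by
    refine (norm_integral_le_integral_norm _).trans_eq ?_
    congr 1
    ext t
    simp [abs_of_nonneg (hρ0 t)]
  refine (integral_mono (hρ.integrable_convolution _ hu).norm
    (hρ.integrable_convolution _ hu.norm) h1).trans_eq ?_
  rw [integral_convolution (ContinuousLinearMap.lsmul ℝ ℝ) hρ hu.norm, hρ1]
  simp

/-- Convergence almost everywhere without loss of mass is convergence in `L¹`. -/
lemma tendsto_integral_norm_sub_zero {a : ℕ → Plane → ℝ} {u : Plane → ℝ}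
    (ha : ∀ n, Integrable (a n)) (hu : Integrable u)
    (hle : ∀ n, ∫ x, ‖a n x‖ ≤ ∫ x, ‖u x‖)
    (hae : ∀ᵐ x : Plane, Tendsto (fun n => a n x) atTop (𝓝 (u x))) :
    Tendsto (fun n => ∫ x, ‖a n x - u x‖) atTop (𝓝 0) := by
  -- dominated convergence applies to `‖a n - u‖ - (‖a n‖ - ‖u‖)`, which lies between `0` and
  -- `2 * ‖u‖`
  have hm : Tendsto (fun n => ∫ x, (‖a n x - u x‖ - (‖a n x‖ - ‖u x‖))) atTop
      (𝓝 (∫ _ : Plane, (0 : ℝ))) := by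
    refine tendsto_integral_of_dominated_convergence (fun x => 2 * ‖u x‖)
      (fun n => ?_) (hu.norm.const_mul 2) (fun n => .of_forall fun x => ?_) ?_
    · exact (((ha n).sub hu).norm.sub ((ha n).norm.sub hu.norm)).aestronglyMeasurable
    · rw [Real.norm_of_nonneg (by linarith [norm_sub_norm_le (a n x) (u x)])]
      linarith [norm_sub_le (a n x) (u x)]
    · filter_upwards [hae] with x hx
      have h1 := (hx.sub_const (u x)).norm.sub (hx.norm.sub_const ‖u x‖)
      simpa using h1
  rw [integral_zero] at hm
  refine squeeze_zero (fun n => integral_nonneg fun x => norm_nonneg _) (fun n => ?_) hm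
  have h1 : Integrable fun x => ‖a n x - u x‖ := ((ha n).sub hu).norm
  have h2 : Integrable fun x => ‖a n x‖ - ‖u x‖ := (ha n).norm.sub hu.norm
  rw [integral_sub h1 h2, integral_sub (ha n).norm hu.norm]
  linarith [hle n]

/-- Smooth approximation of a compactly supported integrable function that does not increase the
total variation. -/
lemma exists_smooth_approx {u : Plane → ℝ} (hu : Integrable u) (huc : HasCompactSupport u) :
    ∃ v : ℕ → Plane → ℝ, (∀ n, ContDiff ℝ ∞ (v n)) ∧ (∀ n, HasCompactSupport (v n)) ∧
      (∀ n, TV (v n) ≤ TV u) ∧ (∀ᵐ x, Tendsto (fun n => v n x) atTop (𝓝 (u x))) ∧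
      Tendsto (fun n => ∫ x, ‖v n x - u x‖) atTop (𝓝 0) := by
  have hr : ∀ n : ℕ, (0 : ℝ) < 1 / ((n : ℝ) + 1) := fun n => Nat.one_div_pos_of_nat
  let φ : ℕ → ContDiffBump (0 : Plane) := fun n =>
    ⟨1 / ((n : ℝ) + 1), 2 * (1 / ((n : ℝ) + 1)), hr n, by linarith [hr n]⟩
  let v : ℕ → Plane → ℝ := fun n =>
    convolution ((φ n).normed volume) u (ContinuousLinearMap.lsmul ℝ ℝ) volume
  have hae : ∀ᵐ x, Tendsto (fun n => v n x) atTop (𝓝 (u x)) := by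
    refine ContDiffBump.ae_convolution_tendsto_right_of_locallyIntegrable (K := 2) ?_
      (.of_forall fun n => le_rfl) hu.locallyIntegrable
    have h := (tendsto_one_div_add_atTop_nhds_zero_nat (𝕜 := ℝ)).const_mul 2
    rwa [mul_zero] at h
  have hi : ∀ n, Integrable ((φ n).normed volume) := fun n => (φ n).integrable_normed
  refine ⟨v, fun n => ?_, fun n => ?_, fun n => ?_, hae, ?_⟩
  · exact (φ n).hasCompactSupport_normed.contDiff_convolution_left _ (φ n).contDiff_normed
      hu.locallyIntegrable
  · exact (φ n).hasCompactSupport_normed.convolution _ huc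
  · exact TV_convolution_le (hi n) (fun x => (φ n).nonneg_normed x) (φ n).integral_normed hu
  · refine tendsto_integral_norm_sub_zero (fun n => ?_) hu (fun n => ?_) hae
    · exact (hi n).integrable_convolution _ hu
    · exact integral_norm_convolution_le (hi n) (fun x => (φ n).nonneg_normed x)
        (φ n).integral_normed hu

/-! ### Additivity of the total variation over truncations -/

lemma exists_hasCompactSupport_ae_eq {u : Plane → ℝ} {Ω : Set Plane}
    (hΩ : Bornology.IsBounded Ω) (hu : Integrable u) (h0 : ∀ᵐ x, x ∉ Ω → u x = 0) :
    ∃ u', Integrable u' ∧ HasCompactSupport u' ∧ u' =ᵐ[volume] u := by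
  refine ⟨(closure Ω).indicator u, hu.indicator isClosed_closure.measurableSet,
    HasCompactSupport.intro hΩ.isCompact_closure fun x hx => indicator_of_notMem hx u, ?_⟩
  filter_upwards [h0] with x hx
  by_cases h : x ∈ closure Ω
  · exact indicator_of_mem h u
  · rw [indicator_of_notMem h, hx fun h' => h (subset_closure h')]

lemma norm_fderiv_comp {f : ℝ → ℝ} (hf : ContDiff ℝ ∞ f) (hf0 : ∀ x, 0 ≤ deriv f x)
    {v : Plane → ℝ} (hv : ContDiff ℝ ∞ v) (x : Plane) :
    ‖fderiv ℝ (fun y => f (v y)) x‖ = deriv f (v x) * ‖fderiv ℝ v x‖ := by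
  have h1 : HasFDerivAt (fun y => f (v y)) (deriv f (v x) • fderiv ℝ v x) x :=
    (hf.differentiable (by simp) (v x)).hasDerivAt.comp_hasFDerivAt x
      (hv.differentiable (by simp) x).hasFDerivAt
  rw [h1.fderiv, norm_smul, Real.norm_of_nonneg (hf0 _)]

lemma abs_sub_le_of_add_eq {f g : ℝ → ℝ} (hf : Monotone f) (hg : Monotone g)
    (hfg : ∀ x, f x + g x = x) (x y : ℝ) : |f x - f y| ≤ |x - y| := by
  rcases le_total x y with h | h
  · rw [abs_of_nonpos (by linarith [hf h]), abs_of_nonpos (by linarith)]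
    linarith [hg h, hfg x, hfg y]
  · rw [abs_of_nonneg (by linarith [hf h]), abs_of_nonneg (by linarith)]
    linarith [hg h, hfg x, hfg y]

/-- If the identity is a sum of two smooth nondecreasing functions, then the total variations of
the two corresponding parts of `u` add up to at most that of `u`. For smooth `u` this is the chain
rule, as `TV u = ∫ |∇u|`; the general case follows by mollification. -/
lemma TV_comp_add_TV_comp_le {f g : ℝ → ℝ} (hf : ContDiff ℝ ∞ f) (hg : ContDiff ℝ ∞ g)
    (hf' : ∀ x, 0 ≤ deriv f x) (hg' : ∀ x, 0 ≤ deriv g x) (hf0 : f 0 = 0) (hg0 : g 0 = 0)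
    (hfg : ∀ x, f x + g x = x) {u : Plane → ℝ} (hu : Integrable u) (huc : HasCompactSupport u) :
    TV (fun x => f (u x)) + TV (fun x => g (u x)) ≤ TV u := by
  have hfm : Monotone f := monotone_of_deriv_nonneg (hf.differentiable (by simp)) hf'
  have hgm : Monotone g := monotone_of_deriv_nonneg (hg.differentiable (by simp)) hg'
  have hd : ∀ x, deriv f x + deriv g x = 1 := fun x => by
    have h1 := ((hf.differentiable (by simp) x).hasDerivAt.add
      (hg.differentiable (by simp) x).hasDerivAt).deriv
    rw [← h1, show f + g = id from funext hfg, deriv_id]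
  have hfl := abs_sub_le_of_add_eq hfm hgm hfg
  have hgl := abs_sub_le_of_add_eq hgm hfm fun x => by rw [add_comm, hfg]
  have hsmooth : ∀ v : Plane → ℝ, ContDiff ℝ ∞ v → HasCompactSupport v →
      TV (fun x => f (v x)) + TV (fun x => g (v x)) ≤ TV v := fun v hv hvc => by
    have hfc : HasCompactSupport fun x => f (v x) := hvc.comp_left hf0
    have hgc : HasCompactSupport fun x => g (v x) := hvc.comp_left hg0
    refine (add_le_add (TV_le_integral_norm_fderiv (hf.comp hv) hfc)
      (TV_le_integral_norm_fderiv (hg.comp hv) hgc)).trans ?_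
    refine le_trans (le_of_eq ?_) (integral_norm_fderiv_le_TV hv hvc)
    rw [← ENNReal.ofReal_add (by positivity) (by positivity),
      ← integral_add (integrable_norm_fderiv (hf.comp hv) hfc)
        (integrable_norm_fderiv (hg.comp hv) hgc)]
    congr 2
    ext x
    simp only [Function.comp_def]
    rw [norm_fderiv_comp hf hf' hv, norm_fderiv_comp hg hg' hv, ← add_mul, hd, one_mul]
  obtain ⟨v, hv, hvc, hvTV, -, hvL⟩ := exists_smooth_approx hu huc
  have key : ∀ p : ℝ → ℝ, ContDiff ℝ ∞ p → p 0 = 0 → (∀ x y, |p x - p y| ≤ |x - y|) →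
      ∀ z ∈ testFields, Tendsto (fun n => ∫ x, p (v n x) * divergence z x) atTop
        (𝓝 (∫ x, p (u x) * divergence z x)) := fun p hp hp0 hpl z hz => by
    have hpi : ∀ w : Plane → ℝ, Integrable w → Integrable fun x => p (w x) := fun w hw =>
      hw.mono (hp.continuous.comp_aestronglyMeasurable hw.aestronglyMeasurable)
        (.of_forall fun x => by simpa [hp0] using hpl (w x) 0)
    have hvi : ∀ n, Integrable (v n) := fun n =>
      (hv n).continuous.integrable_of_hasCompactSupport (hvc n)
    refine tendsto_integral_mul_divergence (fun n => hpi _ (hvi n)) (hpi u hu) ?_ hz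
    refine squeeze_zero (fun n => integral_nonneg fun x => norm_nonneg _) (fun n => ?_) hvL
    exact integral_mono ((hpi _ (hvi n)).sub (hpi u hu)).norm ((hvi n).sub hu).norm
      fun x => hpl _ _
  exact TV_add_TV_le_of_tendsto (key f hf hf0 hfl) (key g hg hg0 hgl)
    (.of_forall fun n => (hsmooth _ (hv n) (hvc n)).trans (hvTV n))

/-- Cutting the graph of `u` at a height `s ≥ 0` splits the total variation. -/
lemma TV_min_add_TV_max_le {u : Plane → ℝ} {Ω : Set Plane} (hΩ : Bornology.IsBounded Ω)
    (hu : Integrable u) (h0 : ∀ᵐ x, x ∉ Ω → u x = 0) {s : ℝ} (hs : 0 ≤ s) :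
    TV (fun x => min (u x) s) + TV (fun x => max (u x - s) 0) ≤ TV u := by
  obtain ⟨u', hu', huc, hae⟩ := exists_hasCompactSupport_ae_eq hΩ hu h0
  rw [← TV_congr hae,
    ← TV_congr (u := fun x => min (u' x) s) (v := fun x => min (u x) s)
      (hae.mono fun x hx => by simp only [hx]),
    ← TV_congr (u := fun x => max (u' x - s) 0) (v := fun x => max (u x - s) 0)
      (hae.mono fun x hx => by simp only [hx])]
  set δ : ℕ → ℝ := fun n => 1 / ((n : ℝ) + 1) with hδ
  have hδ0 : ∀ n, 0 < δ n := fun n => Nat.one_div_pos_of_nat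
  have hδl : Tendsto δ atTop (𝓝 0) := tendsto_one_div_add_atTop_nhds_zero_nat
  have hpos : ∀ n x, 0 < (x - s) ^ 2 + δ n ^ 2 := fun n x => by have := hδ0 n; positivity
  -- smooth nondecreasing approximations of the two truncations, vanishing at `0`
  set g : ℕ → ℝ → ℝ := fun n x =>
    (x - s + √((x - s) ^ 2 + δ n ^ 2)) / 2 - (-s + √(s ^ 2 + δ n ^ 2)) / 2 with hg
  set f : ℕ → ℝ → ℝ := fun n x => x - g n x with hf
  have hg0 : ∀ n, g n 0 = 0 := fun n => by simp [hg]
  have hf0 : ∀ n, f n 0 = 0 := fun n => by simp [hf, hg0]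
  have hgs : ∀ n, ContDiff ℝ ∞ (g n) := fun n => by
    have h1 : ContDiff ℝ ∞ fun x : ℝ => √((x - s) ^ 2 + δ n ^ 2) :=
      ContDiff.sqrt (by fun_prop) fun x => (hpos n x).ne'
    exact (((contDiff_id.sub contDiff_const).add h1).div_const 2).sub contDiff_const
  have hfs : ∀ n, ContDiff ℝ ∞ (f n) := fun n => contDiff_id.sub (hgs n)
  have hgd : ∀ n x, HasDerivAt (g n) ((1 + (x - s) / √((x - s) ^ 2 + δ n ^ 2)) / 2) x :=
    fun n x => by
      have h1 : HasDerivAt (fun x : ℝ => (x - s) ^ 2 + δ n ^ 2) (2 * (x - s)) x := by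
        simpa using (((hasDerivAt_id x).sub_const s).pow 2).add_const (δ n ^ 2)
      have h2 := ((((hasDerivAt_id x).sub_const s).add (h1.sqrt (hpos n x).ne')).div_const
        2).sub_const ((-s + √(s ^ 2 + δ n ^ 2)) / 2)
      refine h2.congr_deriv ?_
      rw [mul_div_mul_left _ _ two_ne_zero]
  have hfd : ∀ n x, HasDerivAt (f n) (1 - (1 + (x - s) / √((x - s) ^ 2 + δ n ^ 2)) / 2) x :=
    fun n x => (hasDerivAt_id x).sub (hgd n x)
  have hq : ∀ n x, |(x - s) / √((x - s) ^ 2 + δ n ^ 2)| ≤ 1 := fun n x => by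
    rw [abs_div, abs_of_nonneg (Real.sqrt_nonneg _)]
    refine div_le_one_of_le₀ (Real.le_sqrt_of_sq_le ?_) (Real.sqrt_nonneg _)
    rw [sq_abs]
    nlinarith [sq_nonneg (δ n)]
  have hg' : ∀ n x, 0 ≤ deriv (g n) x := fun n x => by
    rw [(hgd n x).deriv]
    linarith [(abs_le.1 (hq n x)).1]
  have hf' : ∀ n x, 0 ≤ deriv (f n) x := fun n x => by
    rw [(hfd n x).deriv]
    linarith [(abs_le.1 (hq n x)).2]
  have hfg : ∀ n x, f n x + g n x = x := fun n x => by simp [hf]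
  have hfm : ∀ n, Monotone (f n) := fun n =>
    monotone_of_deriv_nonneg ((hfs n).differentiable (by simp)) (hf' n)
  have hgm : ∀ n, Monotone (g n) := fun n =>
    monotone_of_deriv_nonneg ((hgs n).differentiable (by simp)) (hg' n)
  have hgl : ∀ x, Tendsto (fun n => g n x) atTop (𝓝 (max (x - s) 0)) := fun x => by
    have h1 : ∀ c : ℝ, Tendsto (fun n => √(c ^ 2 + δ n ^ 2)) atTop (𝓝 |c|) := fun c => by
      have := ((hδl.pow 2).const_add (c ^ 2)).sqrt
      rwa [zero_pow two_ne_zero, add_zero, Real.sqrt_sq_eq_abs] at this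
    have h2 := (((h1 (x - s)).const_add (x - s)).div_const 2).sub
      (((h1 s).const_add (-s)).div_const 2)
    convert h2 using 2
    rw [abs_of_nonneg hs]
    rcases le_total (x - s) 0 with h | h
    · rw [max_eq_right h, abs_of_nonpos h]
      ring
    · rw [max_eq_left h, abs_of_nonneg h]
      ring
  have hfl : ∀ x, Tendsto (fun n => f n x) atTop (𝓝 (min x s)) := fun x => by
    convert (hgl x).const_sub x using 2
    rcases le_total x s with h | h
    · rw [min_eq_left h, max_eq_right (by linarith), sub_zero]
    · rw [min_eq_right h, max_eq_left (by linarith), sub_sub_cancel]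
  have key : ∀ (p : ℕ → ℝ → ℝ) (p' : ℝ → ℝ), (∀ n, ContDiff ℝ ∞ (p n)) → (∀ n, p n 0 = 0) →
      (∀ n x y, |p n x - p n y| ≤ |x - y|) → (∀ x, Tendsto (fun n => p n x) atTop (𝓝 (p' x))) →
      ∀ z ∈ testFields, Tendsto (fun n => ∫ x, p n (u' x) * divergence z x) atTop
        (𝓝 (∫ x, p' (u' x) * divergence z x)) := fun p p' hp hp0 hpl hpt z hz =>
    tendsto_integral_mul_divergence_of_dominated
      (fun n => (hp n).continuous.comp_aestronglyMeasurable hu'.aestronglyMeasurable) hu'.norm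
      (fun n x => by simpa [hp0] using hpl n (u' x) 0) (fun x => hpt _) hz
  refine TV_add_TV_le_of_tendsto
    (key f (fun x => min x s) hfs hf0 (fun n => abs_sub_le_of_add_eq (hfm n) (hgm n) (hfg n)) hfl)
    (key g (fun x => max (x - s) 0) hgs hg0
      (fun n => abs_sub_le_of_add_eq (hgm n) (hfm n) fun x => by rw [add_comm, hfg]) hgl)
    (.of_forall fun n => TV_comp_add_TV_comp_le (hfs n) (hgs n) (hf' n) (hg' n) (hf0 n) (hg0 n)
      (hfg n) hu' huc)

/-! ### The Sobolev inequality in the plane -/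

/-- Functions of bounded variation with bounded support are square integrable. -/
lemma exists_eLpNorm_two_le_TV : ∃ C : ENNReal, C ≠ ⊤ ∧ ∀ (u : Plane → ℝ) (Ω : Set Plane),
    Bornology.IsBounded Ω → Integrable u → (∀ᵐ x, x ∉ Ω → u x = 0) →
      eLpNorm u 2 volume ≤ C * TV u := by
  refine ⟨eLpNormLESNormFDerivOneConst (volume : Measure Plane) 2, ENNReal.coe_ne_top,
    fun u Ω hΩ hu h0 => ?_⟩
  obtain ⟨u', hu', huc, hae⟩ := exists_hasCompactSupport_ae_eq hΩ hu h0
  rw [← TV_congr hae, ← eLpNorm_congr_ae hae]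
  obtain ⟨v, hv, hvc, hvTV, hva, -⟩ := exists_smooth_approx hu' huc
  have hp : NNReal.HolderConjugate (Module.finrank ℝ Plane) 2 := by
    rw [finrank_euclideanSpace_fin]
    exact_mod_cast NNReal.HolderConjugate.two_two
  have hb : ∀ n, eLpNorm (v n) 2 volume ≤
      eLpNormLESNormFDerivOneConst (volume : Measure Plane) 2 * TV u' := fun n => by
    refine (eLpNorm_le_eLpNorm_fderiv_one volume ((hv n).of_le (by simp)) (hvc n) hp).trans ?_
    refine mul_le_mul' le_rfl ?_
    refine le_trans (le_of_eq ?_) ((integral_norm_fderiv_le_TV (hv n) (hvc n)).trans (hvTV n))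
    rw [eLpNorm_one_eq_lintegral_enorm, ofReal_integral_norm_eq_lintegral_enorm]
    exact ((hv n).continuous_fderiv (by simp)).integrable_of_hasCompactSupport
      ((hvc n).fderiv (𝕜 := ℝ))
  refine (Lp.eLpNorm_lim_le_liminf_eLpNorm
    (fun n => (hv n).continuous.aestronglyMeasurable) u' hva).trans ?_
  exact liminf_le_of_le (by isBoundedDefault) fun b hb' =>
    (hb'.exists.choose_spec).trans (hb _)

/-! ### Existence of a minimizer -/

/-- Nested nonempty bounded closed convex sets in a Hilbert space have a common point: by the
parallelogram law, their elements of minimal norm form a Cauchy sequence. -/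
lemma nonempty_iInter_of_closed_convex_bounded {H : Type*} [NormedAddCommGroup H]
    [InnerProductSpace ℝ H] [CompleteSpace H] {K : ℕ → Set H} (hanti : Antitone K)
    (hne : ∀ n, (K n).Nonempty) (hcl : ∀ n, IsClosed (K n)) (hconv : ∀ n, Convex ℝ (K n))
    {R : ℝ} (hb : ∀ n, ∀ f ∈ K n, ‖f‖ ≤ R) : (⋂ n, K n).Nonempty := by
  have hmin : ∀ n, ∃ v ∈ K n, ∀ w ∈ K n, ‖v‖ ≤ ‖w‖ := fun n => by
    obtain ⟨v, hv, hvn⟩ := exists_norm_eq_iInf_of_complete_convex (hne n) (hcl n).isComplete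
      (hconv n) 0
    refine ⟨v, hv, fun w hw => ?_⟩
    have h1 : (⨅ w : K n, ‖(0 : H) - w‖) ≤ ‖(0 : H) - w‖ :=
      ciInf_le (f := fun w : K n => ‖(0 : H) - w‖)
        ⟨0, forall_mem_range.2 fun _ => norm_nonneg _⟩ ⟨w, hw⟩
    rw [← hvn] at h1
    simpa using h1
  choose v hv hvm using hmin
  have hmono : Monotone fun n => ‖v n‖ ^ 2 := fun n m hnm => by
    have := hvm n (v m) (hanti hnm (hv m))
    simp only
    gcongr
  obtain ⟨L, hL⟩ : ∃ L, Tendsto (fun n => ‖v n‖ ^ 2) atTop (𝓝 L) :=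
    ⟨_, tendsto_atTop_ciSup hmono ⟨R ^ 2, forall_mem_range.2 fun n => by
      have := hb n (v n) (hv n)
      gcongr⟩⟩
  have hdist : ∀ n m, n ≤ m → ‖v m - v n‖ ^ 2 ≤ 2 * (‖v m‖ ^ 2 - ‖v n‖ ^ 2) := fun n m hnm => by
    have h1 := hvm n ((1 / 2 : ℝ) • v n + (1 / 2 : ℝ) • v m)
      (hconv n (hv n) (hanti hnm (hv m)) (by norm_num) (by norm_num) (by norm_num))
    rw [← smul_add, norm_smul, Real.norm_of_nonneg (by norm_num)] at h1
    have h2 := parallelogram_law_with_norm ℝ (v m) (v n)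
    rw [add_comm (v m) (v n)] at h2
    nlinarith [norm_nonneg (v n), norm_nonneg (v n + v m)]
  have hcauchy : CauchySeq v := by
    rw [Metric.cauchySeq_iff']
    intro ε hε
    obtain ⟨N, hN⟩ := Metric.tendsto_atTop.1 hL (ε ^ 2 / 4) (by positivity)
    refine ⟨N, fun n hn => ?_⟩
    rw [dist_eq_norm]
    refine lt_of_pow_lt_pow_left₀ 2 hε.le ((hdist N n hn).trans_lt ?_)
    have h1 := abs_lt.1 (Real.dist_eq _ _ ▸ hN n hn)
    have h2 := abs_lt.1 (Real.dist_eq _ _ ▸ hN N le_rfl)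
    linarith [h1.2, h2.1]
  obtain ⟨x, hx⟩ := cauchySeq_tendsto_of_complete hcauchy
  exact ⟨x, mem_iInter.2 fun n => (hcl n).mem_of_tendsto hx
    (eventually_atTop.2 ⟨n, fun m hm => hanti hm (hv m)⟩)⟩

lemma integrable_of_memLp_two {u : Plane → ℝ} {Ω : Set Plane} (hΩ : Bornology.IsBounded Ω)
    (hu : MemLp u 2 volume) (h0 : ∀ᵐ x, x ∉ Ω → u x = 0) : Integrable u := by
  have : IsFiniteMeasure (volume.restrict Ω) := ⟨by simpa using hΩ.measure_lt_top⟩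
  have h1 : IntegrableOn u Ω := (hu.restrict Ω).integrable (by norm_num)
  exact h1.integrable_of_ae_notMem_eq_zero h0

lemma tendsto_integral_mul_of_tendsto_Lp {f : ℕ → Lp ℝ 2 (volume : Measure Plane)}
    {g : Lp ℝ 2 (volume : Measure Plane)} (h : Tendsto f atTop (𝓝 g)) {φ : Plane → ℝ}
    (hφ : MemLp φ 2 volume) :
    Tendsto (fun n => ∫ x, f n x * φ x) atTop (𝓝 (∫ x, g x * φ x)) := by
  have e : ∀ w : Lp ℝ 2 (volume : Measure Plane), ∫ x, w x * φ x = inner ℝ w (hφ.toLp φ) :=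
    fun w => by
      rw [L2.inner_def]
      refine integral_congr_ae (hφ.coeFn_toLp.mono fun x hx => ?_)
      simp only [hx]
      exact mul_comm _ _
  simp_rw [e]
  exact h.inner tendsto_const_nhds

/-- The square integrable functions satisfying the constraints of `BVExchange Ω Ωs`, with total
variation at most `c`. -/
def constraintSet (Ω Ωs : Set Plane) (c : ENNReal) : Set (Lp ℝ 2 (volume : Measure Plane)) :=
  {f | TV f ≤ c ∧ ∫ x in Ω, f x = 0 ∧ (∀ᵐ x, x ∈ Ωs → f x = 1) ∧ (∀ᵐ x, x ∉ Ω → f x = 0)}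

lemma isClosed_constraintSet {Ω Ωs : Set Plane} (hΩ : IsOpen Ω) (hΩb : Bornology.IsBounded Ω)
    (c : ENNReal) : IsClosed (constraintSet Ω Ωs c) := by
  refine IsSeqClosed.isClosed fun f g hf hfg => ?_
  obtain ⟨ns, -, hns⟩ := (tendstoInMeasure_of_tendsto_Lp hfg).exists_seq_tendsto_ae
  refine ⟨TV_le_of_tendsto (fun z hz => tendsto_integral_mul_of_tendsto_Lp hfg
    ((continuous_divergence hz).memLp_of_hasCompactSupport (hasCompactSupport_divergence hz)))
    (.of_forall fun n => (hf n).1), ?_, ?_, ?_⟩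
  · have h1 := tendsto_integral_mul_of_tendsto_Lp hfg
      (memLp_indicator_const 2 hΩ.measurableSet (1 : ℝ) (.inr hΩb.measure_lt_top.ne))
    have e : ∀ w : Plane → ℝ, ∫ x, w x * Ω.indicator (fun _ => (1 : ℝ)) x = ∫ x in Ω, w x :=
      fun w => by
        rw [← integral_indicator hΩ.measurableSet]
        congr 1
        ext x
        by_cases hx : x ∈ Ω <;> simp [hx]
    simp_rw [e, fun n => (hf n).2.1] at h1
    exact (tendsto_nhds_unique h1 tendsto_const_nhds)
  · filter_upwards [hns, ae_all_iff.2 fun n => (hf n).2.2.1] with x hx h1 hxs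
    refine tendsto_nhds_unique hx (tendsto_const_nhds.congr fun n => ?_)
    exact (h1 _ hxs).symm
  · filter_upwards [hns, ae_all_iff.2 fun n => (hf n).2.2.2] with x hx h1 hxs
    refine tendsto_nhds_unique hx (tendsto_const_nhds.congr fun n => ?_)
    exact (h1 _ hxs).symm

lemma convex_constraintSet {Ω Ωs : Set Plane} (hΩb : Bornology.IsBounded Ω) (c : ENNReal) :
    Convex ℝ (constraintSet Ω Ωs c) := by
  intro f hf g hg a b ha hb hab
  have hfi := integrable_of_memLp_two hΩb (Lp.memLp f) hf.2.2.2
  have hgi := integrable_of_memLp_two hΩb (Lp.memLp g) hg.2.2.2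
  have hco : (a • f + b • g : Lp ℝ 2 (volume : Measure Plane)) =ᵐ[volume]
      fun x => a * f x + b * g x := by
    filter_upwards [Lp.coeFn_add (a • f) (b • g), Lp.coeFn_smul a f, Lp.coeFn_smul b g]
      with x h1 h2 h3
    rw [h1, Pi.add_apply, h2, h3]
    rfl
  refine ⟨?_, ?_, ?_, ?_⟩
  · rw [TV_congr hco]
    refine (TV_add_le (hfi.const_mul a) (hgi.const_mul b)).trans ?_
    calc TV (fun x => a * f x) + TV (fun x => b * g x)
        ≤ ENNReal.ofReal a * c + ENNReal.ofReal b * c := by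
          refine add_le_add ((TV_const_mul_le a f).trans ?_) ((TV_const_mul_le b g).trans ?_)
          · rw [abs_of_nonneg ha]
            exact mul_le_mul' le_rfl hf.1
          · rw [abs_of_nonneg hb]
            exact mul_le_mul' le_rfl hg.1
      _ = c := by rw [← add_mul, ← ENNReal.ofReal_add ha hb, hab, ENNReal.ofReal_one, one_mul]
  · rw [integral_congr_ae (ae_restrict_of_ae hco),
      integral_add (hfi.const_mul a).integrableOn (hgi.const_mul b).integrableOn,
      integral_const_mul, integral_const_mul, hf.2.1, hg.2.1]
    simp
  · filter_upwards [hco, hf.2.2.1, hg.2.2.1] with x h1 h2 h3 hx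
    rw [h1, h2 hx, h3 hx, mul_one, mul_one, hab]
  · filter_upwards [hco, hf.2.2.2, hg.2.2.2] with x h1 h2 h3 hx
    rw [h1, h2 hx, h3 hx, mul_zero, mul_zero, add_zero]

/-- A minimizer exists: the constraint sets with total variation slightly above the infimum are
nested, closed and convex in `L²`, and bounded by the Sobolev inequality. -/
theorem exists_isTVMinimizer {Ω Ωs : Set Plane} (hΩ : IsOpen Ω) (hΩb : Bornology.IsBounded Ω)
    (hne : (BVExchange Ω Ωs).Nonempty) : ∃ u, IsTVMinimizer Ω Ωs u := by
  obtain ⟨C, hC, hS⟩ := exists_eLpNorm_two_le_TV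
  set m : ENNReal := ⨅ v ∈ BVExchange Ω Ωs, TV v with hm
  have hmle : ∀ v ∈ BVExchange Ω Ωs, m ≤ TV v := fun v hv => iInf₂_le v hv
  have hmtop : m ≠ ⊤ := by
    obtain ⟨v, hv⟩ := hne
    exact ((hmle v hv).trans_lt hv.1.2.2).ne
  set δ : ℕ → ENNReal := fun n => ENNReal.ofReal (1 / ((n : ℝ) + 1)) with hδ
  have hδ0 : ∀ n, 0 < δ n := fun n => ENNReal.ofReal_pos.2 Nat.one_div_pos_of_nat
  have hδl : Tendsto (fun n => m + δ n) atTop (𝓝 m) := by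
    have := (ENNReal.tendsto_ofReal
      (tendsto_one_div_add_atTop_nhds_zero_nat (𝕜 := ℝ))).const_add m
    rwa [ENNReal.ofReal_zero, add_zero] at this
  have hδa : Antitone δ := fun a b hab => ENNReal.ofReal_le_ofReal (Nat.one_div_le_one_div hab)
  set K : ℕ → Set (Lp ℝ 2 (volume : Measure Plane)) := fun n =>
    constraintSet Ω Ωs (m + δ n) with hK
  have hKanti : Antitone K := fun a b hab f hf =>
    ⟨hf.1.trans (add_le_add le_rfl (hδa hab)), hf.2⟩
  have hKne : ∀ n, (K n).Nonempty := fun n => by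
    have h1 : m < m + δ n := ENNReal.lt_add_right hmtop (hδ0 n).ne'
    obtain ⟨v, hv, hvm⟩ : ∃ v ∈ BVExchange Ω Ωs, TV v < m + δ n := by
      simpa only [hm, iInf_lt_iff, exists_prop] using h1
    have hvL : MemLp v 2 volume := ⟨hv.1.2.1.aestronglyMeasurable,
      (hS v Ω hΩb hv.1.2.1 hv.2.2.2).trans_lt (ENNReal.mul_lt_top hC.lt_top hv.1.2.2)⟩
    have hae := hvL.coeFn_toLp
    refine ⟨hvL.toLp v, ?_, ?_, ?_, ?_⟩
    · rw [TV_congr hae]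
      exact hvm.le
    · rw [integral_congr_ae (ae_restrict_of_ae hae)]
      exact hv.2.1
    · filter_upwards [hae, hv.2.2.1] with x h1 h2 hx
      rw [h1, h2 hx]
    · filter_upwards [hae, hv.2.2.2] with x h1 h2 hx
      rw [h1, h2 hx]
  have hKb : ∀ n, ∀ f ∈ K n, ‖f‖ ≤ (C * (m + δ 0)).toReal := fun n f hf => by
    have hf0 : f ∈ K 0 := hKanti (Nat.zero_le n) hf
    rw [Lp.norm_def]
    refine ENNReal.toReal_mono (ENNReal.mul_ne_top hC
      (ENNReal.add_ne_top.2 ⟨hmtop, ENNReal.ofReal_ne_top⟩)) ?_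
    exact (hS f Ω hΩb (integrable_of_memLp_two hΩb (Lp.memLp f) hf.2.2.2) hf.2.2.2).trans
      (mul_le_mul' le_rfl hf0.1)
  obtain ⟨f, hf⟩ := nonempty_iInter_of_closed_convex_bounded hKanti hKne
    (fun n => isClosed_constraintSet hΩ hΩb _) (fun n => convex_constraintSet hΩb _) hKb
  rw [mem_iInter] at hf
  have hfm : TV f ≤ m := ge_of_tendsto' hδl fun n => (hf n).1
  refine ⟨f, ⟨⟨(Lp.stronglyMeasurable f).measurable,
    integrable_of_memLp_two hΩb (Lp.memLp f) (hf 0).2.2.2, hfm.trans_lt hmtop.lt_top⟩,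
    (hf 0).2⟩, fun v hv => hfm.trans (hmle v hv)⟩

/-! ### Competitors -/

lemma add_mem_BV {f g : Plane → ℝ} (hf : f ∈ BV) (hg : g ∈ BV) : (fun x => f x + g x) ∈ BV :=
  ⟨hf.1.add hg.1, hf.2.1.add hg.2.1,
    (TV_add_le hf.2.1 hg.2.1).trans_lt (ENNReal.add_lt_top.2 ⟨hf.2.2, hg.2.2⟩)⟩

lemma const_mul_mem_BV (c : ℝ) {f : Plane → ℝ} (hf : f ∈ BV) : (fun x => c * f x) ∈ BV :=
  ⟨hf.1.const_mul c, hf.2.1.const_mul c,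
    (TV_const_mul_le c f).trans_lt (ENNReal.mul_lt_top ENNReal.ofReal_lt_top hf.2.2)⟩

lemma toReal_TV_const_mul_le {c : ℝ} (hc : 0 ≤ c) {f : Plane → ℝ} (hf : f ∈ BV) :
    (TV fun x => c * f x).toReal ≤ c * (TV f).toReal := by
  have h := ENNReal.toReal_mono (ENNReal.mul_lt_top ENNReal.ofReal_lt_top hf.2.2).ne
    (TV_const_mul_le c f)
  rwa [ENNReal.toReal_mul, ENNReal.toReal_ofReal (abs_nonneg c), abs_of_nonneg hc] at h

lemma indicator_mem_BV {E : Set Plane} (hE : MeasurableSet E) (hv : volume E ≠ ⊤)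
    (hP : Per E ≠ ⊤) : (E.indicator fun _ => (1 : ℝ)) ∈ BV :=
  ⟨measurable_const.indicator hE, (integrable_indicator_iff hE).2 (integrableOn_const hv),
    hP.lt_top⟩

lemma integral_indicator_one' {E : Set Plane} (hE : MeasurableSet E) :
    ∫ x, E.indicator (fun _ => (1 : ℝ)) x = (volume E).toReal := by
  rw [integral_indicator_const _ hE]
  simp [measureReal_def]

lemma volume_ne_top_of_ae_le {Ω E : Set Plane} (hΩ : Bornology.IsBounded Ω)
    (h : E ≤ᵐ[volume] Ω) : volume E ≠ ⊤ :=
  ((measure_mono_ae h).trans_lt hΩ.measure_lt_top).ne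

/-- Subtracting from a function `f` that is `1` on `Ωs` the multiple of a function `g` vanishing on
`Ωs` that makes the mean zero gives a competitor. -/
lemma sub_mul_mem_BVExchange {Ω Ωs : Set Plane} {f g : Plane → ℝ} (hf : f ∈ BV) (hg : g ∈ BV)
    (hfs : ∀ᵐ x, x ∈ Ωs → f x = 1) (hf0 : ∀ᵐ x, x ∉ Ω → f x = 0)
    (hgs : ∀ᵐ x, x ∈ Ωs → g x = 0) (hg0 : ∀ᵐ x, x ∉ Ω → g x = 0)
    (hgi : ∫ x, g x ≠ 0) :
    (fun x => f x - (∫ y, f y) / (∫ y, g y) * g x) ∈ BVExchange Ω Ωs := by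
  have e : (fun x => f x - (∫ y, f y) / (∫ y, g y) * g x) =
      fun x => f x + -((∫ y, f y) / (∫ y, g y)) * g x := by
    ext x
    ring
  rw [e]
  refine ⟨add_mem_BV hf (const_mul_mem_BV _ hg), ?_, ?_, ?_⟩
  · rw [setIntegral_eq_integral_of_ae_compl_eq_zero,
      integral_add hf.2.1 (hg.2.1.const_mul _), integral_const_mul]
    · field_simp
      ring
    · filter_upwards [hf0, hg0] with x h1 h2 hx
      rw [h1 hx, h2 hx, mul_zero, add_zero]
  · filter_upwards [hfs, hgs] with x h1 h2 hx
    rw [h1 hx, h2 hx, mul_zero, add_zero]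
  · filter_upwards [hf0, hg0] with x h1 h2 hx
    rw [h1 hx, h2 hx, mul_zero, add_zero]

lemma TV_sub_mul_le {f g : Plane → ℝ} (hf : Integrable f) (hg : Integrable g) {c : ℝ}
    (hc : 0 ≤ c) : TV (fun x => f x - c * g x) ≤ TV f + ENNReal.ofReal c * TV g := by
  have e : (fun x => f x - c * g x) = fun x => f x + -c * g x := by
    ext x
    ring
  rw [e]
  refine (TV_add_le hf (hg.const_mul _)).trans (add_le_add le_rfl ?_)
  have := TV_const_mul_le (-c) g
  rwa [abs_neg, abs_of_nonneg hc] at this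

/-- Cutting a function of bounded variation at height `s`, with real-valued total variations. -/
lemma cut_BV {Ω : Set Plane} (hΩ : Bornology.IsBounded Ω) {w : Plane → ℝ} (hw : w ∈ BV)
    (h0 : ∀ᵐ x, x ∉ Ω → w x = 0) {s : ℝ} (hs : 0 ≤ s) :
    (fun x => min (w x) s) ∈ BV ∧ (fun x => max (w x - s) 0) ∈ BV ∧
      (TV fun x => min (w x) s).toReal + (TV fun x => max (w x - s) 0).toReal ≤ (TV w).toReal ∧
      (∫ x, min (w x) s) + (∫ x, max (w x - s) 0) = ∫ x, w x := by
  have h := TV_min_add_TV_max_le hΩ hw.2.1 h0 hs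
  have hi1 : Integrable fun x => max (w x - s) 0 :=
    hw.2.1.mono ((hw.1.sub_const s).max measurable_const).aestronglyMeasurable
      (.of_forall fun x => by
        rw [Real.norm_of_nonneg (le_max_right _ _)]
        exact max_le ((sub_le_self _ hs).trans (Real.le_norm_self _)) (norm_nonneg _))
  have e : ∀ x, min (w x) s = w x - max (w x - s) 0 := fun x => by
    rcases le_total (w x) s with h | h
    · rw [min_eq_left h, max_eq_right (by linarith), sub_zero]
    · rw [min_eq_right h, max_eq_left (by linarith), sub_sub_cancel]
  have hi2 : Integrable fun x => min (w x) s := by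
    simp_rw [e]
    exact hw.2.1.sub hi1
  have h1 : TV (fun x => min (w x) s) < ⊤ := (le_self_add.trans h).trans_lt hw.2.2
  have h2 : TV (fun x => max (w x - s) 0) < ⊤ := (le_add_self.trans h).trans_lt hw.2.2
  refine ⟨⟨hw.1.min measurable_const, hi2, h1⟩,
    ⟨(hw.1.sub_const s).max measurable_const, hi1, h2⟩, ?_, ?_⟩
  · rw [← ENNReal.toReal_add h1.ne h2.ne]
    exact ENNReal.toReal_mono hw.2.2.ne h
  · rw [← integral_add hi2 hi1]
    simp_rw [e, sub_add_cancel]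

/-! ### The positive and negative parts of a minimizer -/

lemma posPart_mem_BV {Ω : Set Plane} (hΩ : Bornology.IsBounded Ω) {u : Plane → ℝ} (hu : u ∈ BV)
    (h0 : ∀ᵐ x, x ∉ Ω → u x = 0) :
    (fun x => max (u x) 0) ∈ BV ∧ (fun x => max (-u x) 0) ∈ BV ∧
      (TV fun x => max (u x) 0).toReal + (TV fun x => max (-u x) 0).toReal ≤ (TV u).toReal ∧
      (∫ x, max (u x) 0) - (∫ x, max (-u x) 0) = ∫ x, u x := by
  obtain ⟨h1, h2, h3, h4⟩ := cut_BV hΩ hu h0 le_rfl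
  have e : (fun x => max (-u x) 0) = fun x => -1 * min (u x) 0 := by
    ext x
    rw [neg_one_mul, ← max_neg_neg, neg_zero]
  have e' : ∀ f : Plane → ℝ, (TV fun x => -1 * f x) ≤ TV f := fun f => by
    simpa using TV_const_mul_le (-1) f
  simp only [sub_zero] at h2 h3 h4
  rw [e]
  refine ⟨h2, const_mul_mem_BV _ h1, ?_, ?_⟩
  · have := ENNReal.toReal_mono h1.2.2.ne (e' fun x => min (u x) 0)
    linarith
  · rw [integral_const_mul]
    linarith

section Minimizer

variable {Ω Ωs : Set Plane} {u : Plane → ℝ}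

lemma integral_posPart_eq (hΩb : Bornology.IsBounded Ω) (hu : u ∈ BVExchange Ω Ωs) :
    ∫ x, max (-u x) 0 = ∫ x, max (u x) 0 := by
  have h1 := (posPart_mem_BV hΩb hu.1 hu.2.2.2).2.2.2
  rw [← setIntegral_eq_integral_of_ae_compl_eq_zero hu.2.2.2, hu.2.1] at h1
  linarith

lemma integral_posPart_pos (hΩb : Bornology.IsBounded Ω) (hpos : 0 < volume Ωs)
    (hu : u ∈ BVExchange Ω Ωs) : 0 < ∫ x, max (u x) 0 := by
  refine (integral_pos_iff_support_of_nonneg (f := fun x => max (u x) 0)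
    (fun x => le_max_right _ _) (posPart_mem_BV hΩb hu.1 hu.2.2.2).1.2.1).2 ?_
  refine hpos.trans_le (measure_mono_ae ?_)
  filter_upwards [hu.2.2.1] with x hx hxs
  change max (u x) 0 ≠ 0
  simp [hx hxs]

/-- With `A = ∫ u⁺ = ∫ u⁻`, no function supported where `u ≤ 0` has
a ratio of total variation to mass below `TV u⁻ / A`, since it could replace `u⁻`. -/
lemma TV_negPart_mul_integral_le (hΩb : Bornology.IsBounded Ω) (hmin : IsTVMinimizer Ω Ωs u)
    {w : Plane → ℝ} (hw : w ∈ BV) (hwn : ∀ x, 0 ≤ w x) (hw0 : ∀ᵐ x, x ∉ Ω → w x = 0)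
    (hwu : ∀ᵐ x, 0 < u x → w x = 0) :
    (TV fun x => max (-u x) 0).toReal * ∫ x, w x ≤ (∫ x, max (u x) 0) * (TV w).toReal := by
  obtain ⟨hp, hn, hTV, -⟩ := posPart_mem_BV hΩb hmin.1.1 hmin.1.2.2.2
  rcases (integral_nonneg (μ := volume) (f := w) hwn).eq_or_lt with h0 | h0
  · rw [← h0, mul_zero]
    exact mul_nonneg (integral_nonneg fun x => le_max_right _ _) ENNReal.toReal_nonneg
  have hmem := sub_mul_mem_BVExchange (Ω := Ω) (Ωs := Ωs) hp hw
    (by filter_upwards [hmin.1.2.2.1] with x hx hxs; simp [hx hxs])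
    (by filter_upwards [hmin.1.2.2.2] with x hx hxs; simp [hx hxs])
    (by filter_upwards [hmin.1.2.2.1, hwu] with x hx h1 hxs; exact h1 (by simp [hx hxs]))
    hw0 h0.ne'
  have hc : 0 ≤ (∫ y, max (u y) 0) / ∫ y, w y :=
    div_nonneg (integral_nonneg fun x => le_max_right _ _) h0.le
  have h1 := (hmin.2 _ hmem).trans (TV_sub_mul_le hp.2.1 hw.2.1 hc)
  have h2 := ENNReal.toReal_mono (ENNReal.add_ne_top.2 ⟨hp.2.2.ne,
    (ENNReal.mul_lt_top ENNReal.ofReal_lt_top hw.2.2).ne⟩) h1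
  rw [ENNReal.toReal_add hp.2.2.ne (ENNReal.mul_lt_top ENNReal.ofReal_lt_top hw.2.2).ne,
    ENNReal.toReal_mul, ENNReal.toReal_ofReal hc] at h2
  have h3 : (TV fun x => max (-u x) 0).toReal ≤
      (∫ y, max (u y) 0) / (∫ y, w y) * (TV w).toReal := by linarith
  rwa [div_mul_eq_mul_div, le_div_iff₀ h0] at h3

lemma tendsto_inv_mul_min (a : ℝ) {ε : ℕ → ℝ} (hε : ∀ n, 0 < ε n)
    (hl : Tendsto ε atTop (𝓝 0)) :
    Tendsto (fun n => (ε n)⁻¹ * min (max a 0) (ε n)) atTop (𝓝 (if 0 < a then 1 else 0)) := by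
  split_ifs with h
  · refine tendsto_const_nhds.congr' ?_
    filter_upwards [hl.eventually_lt_const h] with n hn
    rw [max_eq_left h.le, min_eq_right hn.le, inv_mul_cancel₀ (hε n).ne']
  · simp [max_eq_right (not_lt.1 h), min_eq_left (hε _).le]

lemma inv_mul_min_le (a : ℝ) {ε : ℝ} (hε : 0 < ε) :
    ε⁻¹ * min (max a 0) ε ≤ if 0 < a then 1 else 0 := by
  split_ifs with h
  · exact (inv_mul_le_one₀ hε).2 (min_le_right _ _)
  · simp [max_eq_right (not_lt.1 h), hε.le]

/-- The perimeter of a superlevel set, as a limit of the total variations of ever thinner slices: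
a linear bound for all thin slices passes to the limit. The first conjunct keeps the bound from
being truncated by `ENNReal.ofReal`. -/
lemma Per_superlevel_le {f : Plane → ℝ} (hf : Measurable f) (hfin : volume {x | 0 < f x} ≠ ⊤)
    {ε : ℕ → ℝ} (hε : ∀ n, 0 < ε n) (hl : Tendsto ε atTop (𝓝 0)) {M q : ℝ}
    (hBV : ∀ n, (fun x => min (max (f x) 0) (ε n)) ∈ BV)
    (h : ∀ n, (TV fun x => min (max (f x) 0) (ε n)).toReal +
      q * ∫ x, min (max (f x) 0) (ε n) ≤ ε n * M) :
    0 ≤ M - q * (volume {x | 0 < f x}).toReal ∧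
      Per {x | 0 < f x} ≤ ENNReal.ofReal (M - q * (volume {x | 0 < f x}).toReal) := by
  set N : Set Plane := {x | 0 < f x} with hN
  have hNm : MeasurableSet N := measurableSet_lt measurable_const hf
  have hNi : Integrable (N.indicator fun _ => (1 : ℝ)) :=
    (integrable_indicator_iff hNm).2 (integrableOn_const hfin)
  have hind : ∀ x, N.indicator (fun _ => (1 : ℝ)) x = if 0 < f x then 1 else 0 := fun x => by
    simp [indicator_apply, hN]
  set w : ℕ → Plane → ℝ := fun n x => (ε n)⁻¹ * min (max (f x) 0) (ε n) with hw
  have hwBV : ∀ n, w n ∈ BV := fun n => const_mul_mem_BV _ (hBV n)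
  have hwlim : ∀ x, Tendsto (fun n => w n x) atTop (𝓝 (N.indicator (fun _ => (1 : ℝ)) x)) :=
    fun x => by
      rw [hind]
      exact tendsto_inv_mul_min (f x) hε hl
  have hw0 : ∀ n x, 0 ≤ w n x := fun n x =>
    mul_nonneg (inv_nonneg.2 (hε n).le) (le_min (le_max_right _ _) (hε n).le)
  have hwle : ∀ n x, ‖w n x‖ ≤ N.indicator (fun _ => (1 : ℝ)) x := fun n x => by
    rw [Real.norm_of_nonneg (hw0 n x), hind]
    exact inv_mul_min_le (f x) (hε n)
  have hint : Tendsto (fun n => ∫ x, w n x) atTop (𝓝 (volume N).toReal) := by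
    rw [← integral_indicator_one' hNm]
    exact tendsto_integral_of_dominated_convergence _
      (fun n => (hwBV n).2.1.aestronglyMeasurable) hNi (fun n => .of_forall (hwle n))
      (.of_forall hwlim)
  have hbound : ∀ n, (TV (w n)).toReal ≤ M - q * ∫ x, w n x := fun n => by
    have h1 := toReal_TV_const_mul_le (inv_nonneg.2 (hε n).le) (hBV n)
    have h2 := mul_le_mul_of_nonneg_left (h n) (inv_nonneg.2 (hε n).le)
    rw [inv_mul_cancel_left₀ (hε n).ne'] at h2
    simp only [hw, integral_const_mul]
    linarith
  have key : ∀ z ∈ testFields, ∫ x, N.indicator (fun _ => (1 : ℝ)) x * divergence z x ≤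
      M - q * (volume N).toReal := fun z hz => by
    refine le_of_tendsto_of_tendsto' (tendsto_integral_mul_divergence_of_dominated
      (fun n => (hwBV n).2.1.aestronglyMeasurable) hNi hwle hwlim hz)
      ((hint.const_mul q).const_sub M) fun n => ?_
    have h1 := ofReal_integral_le_TV (w n) hz
    rw [ENNReal.ofReal_le_iff_le_toReal (hwBV n).2.2.ne] at h1
    exact h1.trans (hbound n)
  refine ⟨?_, iSup₂_le fun z hz => ENNReal.ofReal_le_ofReal (key z hz)⟩
  simpa [divergence] using key 0 zero_mem_testFields

/-- The set `{u < 0}` has the ratio of perimeter to area given by the slope of `u⁻`: its thin slices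
at the bottom cannot have a larger ratio, as the rest of `u⁻` does not have a smaller one. -/
lemma Per_neg_le (hΩb : Bornology.IsBounded Ω) (hpos : 0 < volume Ωs)
    (hmin : IsTVMinimizer Ω Ωs u) :
    Per {x | u x < 0} ≤ ENNReal.ofReal ((TV fun x => max (-u x) 0).toReal /
      (∫ x, max (u x) 0)) * volume {x | u x < 0} := by
  obtain ⟨-, hn, -, -⟩ := posPart_mem_BV hΩb hmin.1.1 hmin.1.2.2.2
  have hA := integral_posPart_pos hΩb hpos hmin.1
  have hA' := integral_posPart_eq hΩb hmin.1
  set A := ∫ x, max (u x) 0 with hAdef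
  set a := (TV fun x => max (-u x) 0).toReal with ha
  have hn0 : ∀ᵐ x, x ∉ Ω → max (-u x) 0 = 0 := by
    filter_upwards [hmin.1.2.2.2] with x hx hxs
    simp [hx hxs]
  have hset : {x | u x < 0} = {x | 0 < -u x} := by simp
  have hfin : volume {x | 0 < -u x} ≠ ⊤ := volume_ne_top_of_ae_le hΩb <| by
    filter_upwards [hmin.1.2.2.2] with x hx hxn
    by_contra h
    have h1 : 0 < -u x := hxn
    rw [hx h] at h1
    simp at h1
  have key := Per_superlevel_le (f := fun x => -u x) (M := 0) (q := -(a / A)) hmin.1.1.1.neg hfin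
    (fun n : ℕ => Nat.one_div_pos_of_nat) tendsto_one_div_add_atTop_nhds_zero_nat
    (fun n => (cut_BV hΩb hn hn0 Nat.one_div_pos_of_nat.le).1) fun n => by
      have hs : (0 : ℝ) ≤ 1 / ((n : ℝ) + 1) := Nat.one_div_pos_of_nat.le
      obtain ⟨h1, h2, h3, h4⟩ := cut_BV hΩb hn hn0 hs
      have h5 := TV_negPart_mul_integral_le hΩb hmin h2 (fun x => le_max_right _ _)
        (by
          filter_upwards [hn0] with x hx hxs
          rw [hx hxs, zero_sub]
          exact max_eq_right (neg_nonpos.2 hs))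
        (.of_forall fun x hx => by
          rw [max_eq_right (by linarith : -u x ≤ 0), zero_sub]
          exact max_eq_right (neg_nonpos.2 hs))
      rw [hA'] at h4
      rw [mul_zero, neg_mul, ← sub_eq_add_neg, sub_nonpos, div_mul_eq_mul_div, le_div_iff₀ hA]
      have h6 := mul_le_mul_of_nonneg_left h3 hA.le
      have h7 := congrArg (a * ·) h4
      linarith
  rw [hset]
  refine key.2.trans_eq ?_
  rw [zero_sub, neg_mul, neg_neg, ENNReal.ofReal_mul (div_nonneg ENNReal.toReal_nonneg hA.le),
    ENNReal.ofReal_toReal hfin]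

/-- The slope of `u⁻` bounds the Cheeger quotients in the complement of `{u > 0}` from below. -/
lemma slope_le_Per_div (hΩb : Bornology.IsBounded Ω) (hpos : 0 < volume Ωs)
    (hmin : IsTVMinimizer Ω Ωs u) {E : Set Plane} (hE : E ∈ cheegerClass (Ω \ posSupport u)) :
    ENNReal.ofReal ((TV fun x => max (-u x) 0).toReal / (∫ x, max (u x) 0)) ≤
      Per E / volume E := by
  obtain ⟨hEm, hEs, hE0, hEt⟩ := hE
  rcases eq_or_ne (Per E) ⊤ with hP | hP
  · rw [hP, ENNReal.top_div_of_ne_top hEt.ne]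
    exact le_top
  have hA := integral_posPart_pos hΩb hpos hmin.1
  have h := TV_negPart_mul_integral_le hΩb hmin (indicator_mem_BV hEm hEt.ne hP)
    (fun x => indicator_nonneg (fun _ _ => zero_le_one) x)
    (by
      filter_upwards [hEs] with x hx hxs
      exact indicator_of_notMem (fun h => hxs (hx h).1) _)
    (by
      filter_upwards [hEs] with x hx hxs
      exact indicator_of_notMem (fun h => (hx h).2 hxs) _)
  rw [integral_indicator_one' hEm] at h
  change _ ≤ _ * (Per E).toReal at h
  have hv : 0 < (volume E).toReal := ENNReal.toReal_pos hE0.ne' hEt.ne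
  rw [← ENNReal.ofReal_toReal hP, ← ENNReal.ofReal_toReal hEt.ne, ← ENNReal.ofReal_div_of_pos hv]
  refine ENNReal.ofReal_le_ofReal ?_
  rw [div_le_div_iff₀ hA hv]
  linarith

lemma neg_mem_cheegerClass (hΩb : Bornology.IsBounded Ω) (hpos : 0 < volume Ωs)
    (hu : u ∈ BVExchange Ω Ωs) : {x | u x < 0} ∈ cheegerClass (Ω \ posSupport u) := by
  have hle : {x | u x < 0} ≤ᵐ[volume] (Ω \ posSupport u : Set Plane) := by
    filter_upwards [hu.2.2.2] with x hx hxn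
    have hxn' : u x < 0 := hxn
    exact ⟨by_contra fun h => hxn'.ne (hx h), fun h : 0 < u x => hxn'.not_gt h⟩
  refine ⟨measurableSet_lt hu.1.1 measurable_const, hle, ?_,
    (volume_ne_top_of_ae_le hΩb (hle.trans (.of_forall fun x hx => hx.1))).lt_top⟩
  have h1 := integral_posPart_pos hΩb hpos hu
  rw [← integral_posPart_eq hΩb hu] at h1
  refine ((integral_pos_iff_support_of_nonneg (f := fun x => max (-u x) 0)
    (fun x => le_max_right _ _) (posPart_mem_BV hΩb hu.1 hu.2.2.2).2.1.2.1).1 h1).trans_le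
      (measure_mono fun x hx => ?_)
  by_contra h
  have h2 : 0 ≤ u x := not_lt.1 h
  exact hx (max_eq_right (by linarith))

lemma Per_div_neg_le (hΩb : Bornology.IsBounded Ω) (hpos : 0 < volume Ωs)
    (hmin : IsTVMinimizer Ω Ωs u) : Per {x | u x < 0} / volume {x | u x < 0} ≤
      ENNReal.ofReal ((TV fun x => max (-u x) 0).toReal / (∫ x, max (u x) 0)) :=
  ENNReal.div_le_of_le_mul (Per_neg_le hΩb hpos hmin)

lemma isCheegerSet_neg (hΩb : Bornology.IsBounded Ω) (hpos : 0 < volume Ωs)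
    (hmin : IsTVMinimizer Ω Ωs u) : IsCheegerSet (Ω \ posSupport u) {x | u x < 0} := by
  have hN := neg_mem_cheegerClass hΩb hpos hmin.1
  refine ⟨hN, (Per_neg_le hΩb hpos hmin).trans_lt
    (ENNReal.mul_lt_top ENNReal.ofReal_lt_top hN.2.2.2), fun E hE => ?_⟩
  exact (Per_div_neg_le hΩb hpos hmin).trans (slope_le_Per_div hΩb hpos hmin hE)

end Minimizer

/-! ### Level sets and three-valued minimizers -/

section Levels

variable {Ω Ωs Ωm : Set Plane} {u : Plane → ℝ}

/-- A Cheeger set of `Ω \ posSupport u` lies in `Ω`, and `u ≤ 0` on it. -/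
lemma cheegerSet_ae (hm : IsCheegerSet (Ω \ posSupport u) Ωm) :
    ∀ᵐ x, x ∈ Ωm → x ∈ Ω ∧ u x ≤ 0 := by
  filter_upwards [hm.1.2.1] with x hx hxm
  exact ⟨(hx hxm).1, not_lt.1 (hx hxm).2⟩

/-- Balancing `w` on a Cheeger set gives a competitor; for `w` an indicator it is `threeValued`. -/
lemma threeValued_competitor (hu : u ∈ BVExchange Ω Ωs)
    (hm : IsCheegerSet (Ω \ posSupport u) Ωm) {w : Plane → ℝ} (hw : w ∈ BV)
    (hwn : ∀ x, 0 ≤ w x) (hws : ∀ᵐ x, x ∈ Ωs → w x = 1) (hw0 : ∀ᵐ x, x ∉ Ω → w x = 0) :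
    (fun x => w x - (∫ y, w y) / (volume Ωm).toReal * Ωm.indicator (fun _ => (1 : ℝ)) x) ∈
        BVExchange Ω Ωs ∧
      TV (fun x => w x -
        (∫ y, w y) / (volume Ωm).toReal * Ωm.indicator (fun _ => (1 : ℝ)) x) ≤
        TV w + ENNReal.ofReal (∫ y, w y) * (Per Ωm / volume Ωm) := by
  have hmae := cheegerSet_ae hm
  obtain ⟨⟨hmm, -, hm0, hmt⟩, hmP, -⟩ := hm
  have hv : 0 < (volume Ωm).toReal := ENNReal.toReal_pos hm0.ne' hmt.ne
  have hg := indicator_mem_BV hmm hmt.ne hmP.ne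
  constructor
  · have h := sub_mul_mem_BVExchange (Ω := Ω) (Ωs := Ωs) hw hg hws hw0
      (by
        filter_upwards [hmae, hu.2.2.1] with x h1 h2 hxs
        refine indicator_of_notMem (fun h => ?_) _
        linarith [(h1 h).2, h2 hxs])
      (by
        filter_upwards [hmae] with x h1 hx
        exact indicator_of_notMem (fun h => hx (h1 h).1) _)
      (by rw [integral_indicator_one' hmm]; exact hv.ne')
    rwa [integral_indicator_one' hmm] at h
  · have hi : 0 ≤ ∫ y, w y := integral_nonneg hwn
    refine (TV_sub_mul_le hw.2.1 hg.2.1 (div_nonneg hi hv.le)).trans_eq ?_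
    rw [ENNReal.ofReal_div_of_pos hv, ENNReal.ofReal_toReal hmt.ne, div_eq_mul_inv, div_eq_mul_inv,
      mul_assoc, mul_comm (volume Ωm)⁻¹]
    rfl

lemma threeValued_competitor_of_between (hΩb : Bornology.IsBounded Ω) (hu : u ∈ BVExchange Ω Ωs)
    (hm : IsCheegerSet (Ω \ posSupport u) Ωm) {E : Set Plane} (hE : E ∈ betweenClass Ω Ωs Ωm)
    (hP : Per E ≠ ⊤) :
    threeValued E Ωm ∈ BVExchange Ω Ωs ∧ TV (threeValued E Ωm) ≤ TFun Ωm E := by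
  have hfin : volume E ≠ ⊤ :=
    volume_ne_top_of_ae_le hΩb (hE.2.2.trans (.of_forall fun x hx => hx.1))
  have h := threeValued_competitor hu hm (indicator_mem_BV hE.1 hfin hP)
    (fun x => indicator_nonneg (fun _ _ => zero_le_one) x)
    (by
      filter_upwards [hE.2.1] with x hx hxs
      exact indicator_of_mem (hx hxs) _)
    (by
      filter_upwards [hE.2.2] with x hx hxs
      exact indicator_of_notMem (fun h => hxs (hx h).1) _)
  rw [integral_indicator_one' hE.1, ENNReal.ofReal_toReal hfin, mul_comm] at h
  exact h

lemma TV_le_TFun (hΩb : Bornology.IsBounded Ω) (hmin : IsTVMinimizer Ω Ωs u)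
    (hm : IsCheegerSet (Ω \ posSupport u) Ωm) {E : Set Plane}
    (hE : E ∈ betweenClass Ω Ωs Ωm) : TV u ≤ TFun Ωm E := by
  rcases eq_or_ne (Per E) ⊤ with hP | hP
  · simp [TFun, hP]
  · have h := threeValued_competitor_of_between hΩb hmin.1 hm hE hP
    exact (hmin.2 _ h.1).trans h.2

/-- The relaxation of `TFun Ωm` to functions `w` with `w = c` on `Ωs` is bounded below by
`c * TV u`. -/
lemma mul_TV_le_relaxed (hmin : IsTVMinimizer Ω Ωs u)
    (hm : IsCheegerSet (Ω \ posSupport u) Ωm) {w : Plane → ℝ} (hw : w ∈ BV)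
    (hwn : ∀ x, 0 ≤ w x) {c : ℝ} (hc : 0 ≤ c) (hws : ∀ᵐ x, x ∈ Ωs → w x = c)
    (hw0 : ∀ᵐ x, x ∉ Ω → w x = 0) :
    c * (TV u).toReal ≤ (TV w).toReal + (Per Ωm / volume Ωm).toReal * ∫ x, w x := by
  rcases hc.eq_or_lt with rfl | hc
  · rw [zero_mul]
    have := integral_nonneg (μ := volume) (f := w) hwn
    positivity
  have hq : Per Ωm / volume Ωm ≠ ⊤ := ENNReal.div_ne_top hm.2.1.ne hm.1.2.2.1.ne'
  have hw' := const_mul_mem_BV c⁻¹ hw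
  obtain ⟨h1, h2⟩ := threeValued_competitor hmin.1 hm hw'
    (fun x => mul_nonneg (inv_nonneg.2 hc.le) (hwn x))
    (by
      filter_upwards [hws] with x hx hxs
      rw [hx hxs, inv_mul_cancel₀ hc.ne'])
    (by
      filter_upwards [hw0] with x hx hxs
      rw [hx hxs, mul_zero])
  have hi : 0 ≤ ∫ x, c⁻¹ * w x :=
    integral_nonneg fun x => mul_nonneg (inv_nonneg.2 hc.le) (hwn x)
  have hfin := ENNReal.mul_ne_top (ENNReal.ofReal_ne_top (r := ∫ x, c⁻¹ * w x)) hq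
  have h3 := ENNReal.toReal_mono (ENNReal.add_ne_top.2 ⟨hw'.2.2.ne, hfin⟩)
    ((hmin.2 _ h1).trans h2)
  rw [ENNReal.toReal_add hw'.2.2.ne hfin, ENNReal.toReal_mul, ENNReal.toReal_ofReal hi,
    integral_const_mul] at h3
  have h4 := h3.trans (add_le_add_left (toReal_TV_const_mul_le (inv_nonneg.2 hc.le) hw) _)
  have h5 := mul_le_mul_of_nonneg_left h4 hc.le
  refine h5.trans_eq ?_
  field_simp

/-- The slices of `u⁺` at the heights `[0, t]`, `[t, t + ε]` and `[t + ε, ∞)` equal `t`, `ε` and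
`1 - t - ε` on `Ωs`, so `mul_TV_le_relaxed` bounds the relaxed energy of each from below by that
multiple of `TV u`. As the energies add up to at most `TV u`, that of the middle slice is at most
`ε * TV u`, and `ε → 0` gives the claim. -/
lemma TFun_superlevel_le (hΩb : Bornology.IsBounded Ω) (hpos : 0 < volume Ωs)
    (hmin : IsTVMinimizer Ω Ωs u) (hm : IsCheegerSet (Ω \ posSupport u) Ωm) {t : ℝ}
    (ht0 : 0 ≤ t) (ht1 : t < 1) : TFun Ωm {x | t < u x} ≤ TV u := by
  obtain ⟨hp, hn, hTV, -⟩ := posPart_mem_BV hΩb hmin.1.1 hmin.1.2.2.2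
  have hA := integral_posPart_pos hΩb hpos hmin.1
  have hq : Per Ωm / volume Ωm ≠ ⊤ := ENNReal.div_ne_top hm.2.1.ne hm.1.2.2.1.ne'
  -- a Cheeger set has no larger quotient than `{u < 0}`, whose quotient is the slope of `u⁻`
  have hslope : (Per Ωm / volume Ωm).toReal * ∫ x, max (u x) 0 ≤
      (TV fun x => max (-u x) 0).toReal := by
    rw [← le_div_iff₀ hA]
    refine ENNReal.toReal_le_of_le_ofReal (div_nonneg ENNReal.toReal_nonneg hA.le) ?_
    exact (hm.2.2 _ (neg_mem_cheegerClass hΩb hpos hmin.1)).trans (Per_div_neg_le hΩb hpos hmin)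
  set q := (Per Ωm / volume Ωm).toReal with hqdef
  have hq0 : 0 ≤ q := ENNReal.toReal_nonneg
  have hp0 : ∀ᵐ x, x ∉ Ω → max (u x) 0 = 0 := by
    filter_upwards [hmin.1.2.2.2] with x hx hxs
    simp [hx hxs]
  have hset : {x | t < u x} = {x | 0 < u x - t} := by simp
  have hfin : volume {x | 0 < u x - t} ≠ ⊤ := volume_ne_top_of_ae_le hΩb <| by
    filter_upwards [hmin.1.2.2.2] with x hx hxn
    by_contra h
    have h1 : 0 < u x - t := hxn
    rw [hx h] at h1
    linarith
  -- thicknesses tending to `0` with `t + ε n ≤ 1`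
  set ε : ℕ → ℝ := fun n => (1 - t) * (1 / ((n : ℝ) + 1)) with hε
  have hε0 : ∀ n, 0 < ε n := fun n => mul_pos (by linarith) Nat.one_div_pos_of_nat
  have hεt : ∀ n, t + ε n ≤ 1 := fun n => by
    have h1 : 1 / ((n : ℝ) + 1) ≤ 1 := by
      rw [div_le_one (by positivity)]
      linarith [(Nat.cast_nonneg n : (0 : ℝ) ≤ n)]
    have h2 : ε n ≤ (1 - t) * 1 := mul_le_mul_of_nonneg_left h1 (by linarith)
    linarith
  have hεl : Tendsto ε atTop (𝓝 0) := by
    have := (tendsto_one_div_add_atTop_nhds_zero_nat (𝕜 := ℝ)).const_mul (1 - t)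
    rwa [mul_zero] at this
  have hr : ∀ x, max (max (u x) 0 - t) 0 = max (u x - t) 0 := fun x => by
    rcases le_total (u x) 0 with h | h
    · rw [max_eq_right h, max_eq_right (by linarith), max_eq_right (by linarith)]
    · rw [max_eq_left h]
  have hs1 : ∀ᵐ x, x ∈ Ωs → max (u x - t) 0 = 1 - t := by
    filter_upwards [hmin.1.2.2.1] with x hx hxs
    rw [hx hxs, max_eq_left (by linarith)]
  have h01 : ∀ᵐ x, x ∉ Ω → max (u x - t) 0 = 0 := by
    filter_upwards [hmin.1.2.2.2] with x hx hxs
    rw [hx hxs, max_eq_right (by linarith)]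
  obtain ⟨a1, a2, a3, a4⟩ := cut_BV hΩb hp hp0 ht0
  simp only [hr] at a2 a3 a4
  have slice1 := mul_TV_le_relaxed hmin hm a1 (fun x => le_min (le_max_right _ _) ht0) ht0
    (by
      filter_upwards [hmin.1.2.2.1] with x hx hxs
      rw [hx hxs, max_eq_left zero_le_one, min_eq_right ht1.le])
    (by
      filter_upwards [hp0] with x hx hxs
      rw [hx hxs, min_eq_left ht0])
  have key := Per_superlevel_le (f := fun x => u x - t) (M := (TV u).toReal) (q := q)
    (hmin.1.1.1.sub_const t) hfin hε0 hεl (fun n => (cut_BV hΩb a2 h01 (hε0 n).le).1) fun n => by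
      obtain ⟨-, b2, b3, b4⟩ := cut_BV hΩb a2 h01 (hε0 n).le
      have slice3 := mul_TV_le_relaxed hmin hm b2 (fun x => le_max_right _ _)
        (c := 1 - t - ε n) (by linarith [hεt n])
        (by
          filter_upwards [hs1] with x hx hxs
          rw [hx hxs, max_eq_left (by linarith [hεt n])])
        (by
          filter_upwards [h01] with x hx hxs
          rw [hx hxs, max_eq_right (by linarith [hε0 n])])
      rw [← b4] at a4
      rw [← a4] at hslope
      linarith
  have hTFin : (TV u) ≠ ⊤ := hmin.1.1.2.2.ne
  rw [TFun, hset]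
  set V := (volume {x | 0 < u x - t}).toReal with hV
  have hqV : Per Ωm / volume Ωm * volume {x | 0 < u x - t} = ENNReal.ofReal (q * V) := by
    rw [ENNReal.ofReal_mul hq0, hqdef, hV, ENNReal.ofReal_toReal hq, ENNReal.ofReal_toReal hfin]
  rw [hqV]
  refine (add_le_add key.2 le_rfl).trans_eq ?_
  rw [← ENNReal.ofReal_add key.1 (mul_nonneg hq0 ENNReal.toReal_nonneg), sub_add_cancel,
    ENNReal.ofReal_toReal hTFin]

lemma superlevel_mem_betweenClass (hu : u ∈ BVExchange Ω Ωs)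
    (hm : IsCheegerSet (Ω \ posSupport u) Ωm) {t : ℝ} (ht0 : 0 ≤ t) (ht1 : t < 1) :
    {x | t < u x} ∈ betweenClass Ω Ωs Ωm := by
  refine ⟨measurableSet_lt measurable_const hu.1.1, ?_, ?_⟩
  · filter_upwards [hu.2.2.1] with x hx hxs
    change t < u x
    rwa [hx hxs]
  · filter_upwards [hu.2.2.2, cheegerSet_ae hm] with x h1 h2 hxt
    have hxt' : t < u x := hxt
    refine ⟨by_contra fun h => ?_, fun h => ?_⟩
    · linarith [h1 h]
    · linarith [(h2 h).2]

end Levels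

theorem mainTheorem1 (Ω Ωs : Set Plane) (hΩ : IsOpen Ω) (hΩb : Bornology.IsBounded Ω)
    (hΩs : MeasurableSet Ωs) (hsub : Ωs ⊆ Ω) (hpos : 0 < volume Ωs)
    (hne : (BVExchange Ω Ωs).Nonempty) :
    (∃ u, IsTVMinimizer Ω Ωs u) ∧
    ∀ u, IsTVMinimizer Ω Ωs u →
      (∃ Ωm, IsCheegerSet (Ω \ posSupport u) Ωm) ∧
      ∀ Ωm, IsCheegerSet (Ω \ posSupport u) Ωm →
        (∃ Ω₁, IsTMinimizer Ω Ωs Ωm Ω₁) ∧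
        (∀ Ω₁, IsTMinimizer Ω Ωs Ωm Ω₁ → IsTVMinimizer Ω Ωs (threeValued Ω₁ Ωm)) ∧
        (∀ t : ℝ, 0 ≤ t → t < 1 → IsTMinimizer Ω Ωs Ωm {x | t < u x}) := by
  refine ⟨exists_isTVMinimizer hΩ hΩb hne, fun u hmin =>
    ⟨⟨_, isCheegerSet_neg hΩb hpos hmin⟩, fun Ωm hm => ?_⟩⟩
  have hlevel : ∀ t : ℝ, 0 ≤ t → t < 1 → IsTMinimizer Ω Ωs Ωm {x | t < u x} := fun t ht0 ht1 =>
    ⟨superlevel_mem_betweenClass hmin.1 hm ht0 ht1, fun E hE =>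
      (TFun_superlevel_le hΩb hpos hmin hm ht0 ht1).trans (TV_le_TFun hΩb hmin hm hE)⟩
  refine ⟨⟨_, hlevel 0 le_rfl one_pos⟩, fun Ω₁ h₁ => ?_, hlevel⟩
  have hT : TFun Ωm Ω₁ ≤ TV u :=
    (h₁.2 _ (superlevel_mem_betweenClass hmin.1 hm le_rfl one_pos)).trans
      (TFun_superlevel_le hΩb hpos hmin hm le_rfl one_pos)
  have hP : Per Ω₁ ≠ ⊤ := ((le_self_add.trans hT).trans_lt hmin.1.1.2.2).ne
  have hc := threeValued_competitor_of_between hΩb hmin.1 hm h₁.1 hP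
  exact ⟨hc.1, fun v hv => hc.2.trans (hT.trans (hmin.2 v hv))⟩
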